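/- Let $\mathbb F$ be a field of characteristic $0$, $\mathcal A=\mathbb F[x_1,\dots,x_n]$, and let $L_{n+1}=\sum_{i,j}\mathbb F x_i\partial_{x_j}+\sum_i\mathbb F\partial_{x_i}+\sum_i\mathbb F p_i$ with $p_i=x_i\sum_{k=1}^n x_k\partial_{x_k}$, a Lie algebra of derivations of $\mathcal A$ (isomorphic to $sl(n+1)$); put $P=\sum_i\mathbb F p_i$. Let $V$ be a finite-dimensional irreducible $gl(n)$-module over $\mathbb F$ with a highest weight vector of weight $\mu=(\mu_1,\dots,\mu_n)\in\mathbb F^n$, and let $L_{n+1}$ act on $\mathcal A\otimes_{\mathbb F} V$ by $$\Big(\sum_i a_i\partial_{x_i}\Big).(f\otimes v)=\sum_{i,j}\partial_{x_i}(a_j)f\otimes E_{i,j}v+\sum_i a_i\partial_{x_i}(f)\otimes v .$$ Write $|\mu|=\sum_i\mu_i$, and for $j\in\mathbb N$ let $I(\mu,j)$ be the set of $\underline c=(c_1,\dots,c_n)\in\mathbb N^n$ with $\sum_i c_i=j$ and $c_{s+1}\le\mu_s-\mu_{s+1}$ for $1\le s\le n-1$. Let $(\mathcal A\otimes V)_{\langle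 j\rangle}$ be the span of the $x^{\underline l}\otimes v$ with $|\underline l|=j$, $v\in V$, and let $\varphi_j$ be the linear map on it with $\varphi_j(x^{\underline l}\otimes v)=p_1^{l_1}\cdots p_n^{l_n}.(1\otimes v)$. For $\underline c\in I(\mu,j)$ put $$q_{\underline c}=\prod_{s=1}^n\prod_{i=1}^{c_s}(\mu_s+|\mu|-s+i).$$ (a) For every $j\in\mathbb N$ and $\underline c\in I(\mu,j)$, there is a maximal vector of weight $\mu+\underline c$ in $(\mathcal A\otimes V)_{\langle j\rangle}$ for $\sum_{i,j}\mathbb F x_i\partial_{x_j}\cong gl(n)$, and every such maximal vector $\xi$ satisfies $\varphi_j(\xi)=q_{\underline c}\,\xi$. (A maximal vector of weight $\nu$ is a nonzero vector killed by all $x_i\partial_{x_k}$, $i<k$, on which each $x_i\partial_{x_i}$ acts by $\nu_i$.) (b) The $L_{n+1}$-module $\mathcal A\otimes_{\mathbb F}V$ is irreducible if and only if $q_{\underline c}\ne 0$ for all $j>0$ and all $\underline c\in I(\mu,j)$. (c) The $L_{n+1}$-module $\mathcal A\otimes_{\mathbb F}V$ is irreducible if and only if $\mathcal A\otimes_{\mathbb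 F}V=U(P)(1\otimes V)$, where $U(P)$ is the universal enveloping algebra of the abelian Lie algebra $P$. -/

import Mathlib

open scoped TensorProduct

attribute [local instance 100] LieRing.ofAssociativeRing

namespace GenProj

noncomputable section

/-! ### The Witt algebra and the Lie algebra of the projective group -/

/-- The polynomial algebra `𝒜 = F[x₁, …, xₙ]`. -/
abbrev Poly (F : Type*) [Field F] (n : ℕ) := MvPolynomial (Fin n) F

/-- The Witt algebra `𝒲(n) = {∑ fᵢ ∂ᵢ}`, i.e. the Lie algebra of all derivations of `𝒜`. -/
def Witt (F : Type*) [Field F] (n : ℕ) := Derivation F (Poly F n) (Poly F n)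

instance (F : Type*) [Field F] (n : ℕ) : LieRing (Witt F n) :=
  inferInstanceAs (LieRing (Derivation F (Poly F n) (Poly F n)))

instance (F : Type*) [Field F] (n : ℕ) : LieAlgebra F (Witt F n) :=
  inferInstanceAs (LieAlgebra F (Derivation F (Poly F n) (Poly F n)))

instance (F : Type*) [Field F] (n : ℕ) : Module (Poly F n) (Witt F n) :=
  inferInstanceAs (Module (Poly F n) (Derivation F (Poly F n) (Poly F n)))

/-- The action of a vector field on polynomials: `act D f = D(f)`. -/
def act {F : Type*} [Field F] {n : ℕ} : Witt F n →ₗ[F] Module.End F (Poly F n) where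
  toFun D := Derivation.toLinearMap D
  map_add' _ _ := rfl
  map_smul' _ _ := rfl

theorem act_lie {F : Type*} [Field F] {n : ℕ} (D E : Witt F n) (f : Poly F n) :
    act ⁅D, E⁆ f = act D (act E f) - act E (act D f) := rfl

theorem act_poly_smul {F : Type*} [Field F] {n : ℕ} (f : Poly F n) (D : Witt F n) (g : Poly F n) :
    act (f • D) g = f * act D g := rfl

theorem act_mul {F : Type*} [Field F] {n : ℕ} (D : Witt F n) (f g : Poly F n) :
    act D (f * g) = f * act D g + g * act D f :=
  Derivation.leibniz (D : Derivation F (Poly F n) (Poly F n)) f g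

theorem act_one {F : Type*} [Field F] {n : ℕ} (D : Witt F n) : act D 1 = 0 :=
  Derivation.map_one_eq_zero (D : Derivation F (Poly F n) (Poly F n))

theorem witt_ext {F : Type*} [Field F] {n : ℕ} {D E : Witt F n}
    (h : ∀ k, act D (MvPolynomial.X k) = act E (MvPolynomial.X k)) : D = E :=
  MvPolynomial.derivation_ext h

/-- The general linear Lie algebra `gl(n)` of `n × n` matrices. -/
abbrev Gl (F : Type*) [Field F] (n : ℕ) := Matrix (Fin n) (Fin n) F

/-- The matrix unit `E_{i,j}`. -/
abbrev matE (F : Type*) [Field F] {n : ℕ} (i j : Fin n) : Gl F n := Matrix.single i j 1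

/-- The partial derivative `∂_{x_i}`. -/
def dX (F : Type*) [Field F] {n : ℕ} (i : Fin n) : Witt F n :=
  (MvPolynomial.pderiv i : Derivation F (Poly F n) (Poly F n))

/-- The vector field `x_i ∂_{x_j}`. -/
def xd (F : Type*) [Field F] {n : ℕ} (i j : Fin n) : Witt F n :=
  (MvPolynomial.X i : Poly F n) • dX F j

/-- The pseudo-translation operator `p_i = x_i ∑ₖ xₖ ∂_{xₖ}`. -/
def pT (F : Type*) [Field F] {n : ℕ} (i : Fin n) : Witt F n :=
  (MvPolynomial.X i : Poly F n) • ∑ k, xd F k k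

theorem dX_X (F : Type*) [Field F] {n : ℕ} (i k : Fin n) :
    act (dX F i) (MvPolynomial.X k) = if i = k then 1 else 0 := by
  change MvPolynomial.pderiv i (MvPolynomial.X k : Poly F n) = _
  simp [MvPolynomial.pderiv_X, Pi.single_apply, eq_comm]

theorem xd_X (F : Type*) [Field F] {n : ℕ} (i j k : Fin n) :
    act (xd F i j) (MvPolynomial.X k) = if j = k then MvPolynomial.X i else 0 := by
  simp [xd, act_poly_smul, dX_X]

theorem euler_X (F : Type*) [Field F] {n : ℕ} (m : Fin n) :
    act (∑ k, xd F k k) (MvPolynomial.X m) = MvPolynomial.X m := by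
  simp [map_sum, LinearMap.sum_apply, xd_X]

theorem pT_X (F : Type*) [Field F] {n : ℕ} (i k : Fin n) :
    act (pT F i) (MvPolynomial.X k) = MvPolynomial.X i * MvPolynomial.X k := by
  rw [pT, act_poly_smul, euler_X]

theorem lie_pT_pT (F : Type*) [Field F] {n : ℕ} (i j : Fin n) : ⁅pT F i, pT F j⁆ = 0 := by
  apply witt_ext
  intro k
  simp only [act_lie, act_mul, pT_X, map_zero, LinearMap.zero_apply]
  ring

theorem lie_dX_dX (F : Type*) [Field F] {n : ℕ} (i j : Fin n) : ⁅dX F i, dX F j⁆ = 0 := by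
  apply witt_ext
  intro k
  simp only [act_lie, dX_X]
  split_ifs <;> simp [act_one]

theorem lie_xd_dX (F : Type*) [Field F] {n : ℕ} (i j k : Fin n) :
    ⁅xd F i j, dX F k⁆ = -(if k = i then dX F j else 0) := by
  apply witt_ext
  intro l
  simp only [act_lie, dX_X, xd_X, map_neg, LinearMap.neg_apply]
  split_ifs <;> simp_all [dX_X, act_one]

theorem lie_xd_xd (F : Type*) [Field F] {n : ℕ} (i j k l : Fin n) :
    ⁅xd F i j, xd F k l⁆ = (if j = k then xd F i l else 0) - (if l = i then xd F k j else 0) := by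
  apply witt_ext
  intro m
  simp only [act_lie, xd_X, map_sub, LinearMap.sub_apply]
  split_ifs <;> simp_all [xd_X]

theorem lie_xd_pT (F : Type*) [Field F] {n : ℕ} (i j k : Fin n) :
    ⁅xd F i j, pT F k⁆ = if j = k then pT F i else 0 := by
  apply witt_ext
  intro m
  simp only [act_lie, act_mul, xd_X, pT_X]
  split_ifs <;> simp_all [pT_X] <;> ring

theorem lie_dX_pT (F : Type*) [Field F] {n : ℕ} (j i : Fin n) :
    ⁅dX F j, pT F i⁆ = xd F i j + if j = i then ∑ k, xd F k k else 0 := by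
  apply witt_ext
  intro m
  simp only [act_lie, act_mul, dX_X, pT_X, map_add, LinearMap.add_apply, xd_X]
  split_ifs with h₁ h₂ h₂ <;> simp_all [euler_X, act_one, -map_sum]

/-- The vector space `∑ F x_i ∂_{x_j} + ∑ F ∂_{x_i} + ∑ F p_i`. -/
def projSpan (F : Type*) [Field F] (n : ℕ) : Submodule F (Witt F n) :=
  Submodule.span F (Set.range fun ij : Fin n × Fin n => xd F ij.1 ij.2) ⊔
    Submodule.span F (Set.range (dX F)) ⊔ Submodule.span F (Set.range (pT F))

theorem xd_mem (F : Type*) [Field F] {n : ℕ} (i j : Fin n) : xd F i j ∈ projSpan F n :=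
  Submodule.mem_sup_left (Submodule.mem_sup_left (Submodule.subset_span ⟨(i, j), rfl⟩))

theorem dX_mem (F : Type*) [Field F] {n : ℕ} (i : Fin n) : dX F i ∈ projSpan F n :=
  Submodule.mem_sup_left (Submodule.mem_sup_right (Submodule.subset_span ⟨i, rfl⟩))

theorem pT_mem (F : Type*) [Field F] {n : ℕ} (i : Fin n) : pT F i ∈ projSpan F n :=
  Submodule.mem_sup_right (Submodule.subset_span ⟨i, rfl⟩)

theorem projSpan_induction (F : Type*) [Field F] {n : ℕ} (N : Submodule F (Witt F n))
    (h₁ : ∀ i j, xd F i j ∈ N) (h₂ : ∀ i, dX F i ∈ N) (h₃ : ∀ i, pT F i ∈ N) :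
    projSpan F n ≤ N := by
  refine sup_le (sup_le ?_ ?_) ?_ <;> rw [Submodule.span_le] <;> rintro _ ⟨a, rfl⟩
  · exact h₁ _ _
  · exact h₂ _
  · exact h₃ _

theorem lie_mem_projSpan (F : Type*) [Field F] {n : ℕ} {D E : Witt F n}
    (hD : D ∈ projSpan F n) (hE : E ∈ projSpan F n) : ⁅D, E⁆ ∈ projSpan F n := by
  have hskew : ∀ A B : Witt F n, ⁅A, B⁆ ∈ projSpan F n → ⁅B, A⁆ ∈ projSpan F n := by
    intro A B h
    rw [← lie_skew]
    exact neg_mem h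
  have hite : ∀ (p : Prop) [Decidable p] (A : Witt F n), A ∈ projSpan F n →
      (if p then A else 0) ∈ projSpan F n := by
    intro p _ A hA
    split_ifs
    exacts [hA, zero_mem _]
  have hxd : ∀ i j k : Fin n, ⁅xd F i j, dX F k⁆ ∈ projSpan F n := fun i j k => by
    rw [lie_xd_dX]
    exact neg_mem (hite _ _ (dX_mem F j))
  have hxp : ∀ i j k : Fin n, ⁅xd F i j, pT F k⁆ ∈ projSpan F n := fun i j k => by
    rw [lie_xd_pT]
    exact hite _ _ (pT_mem F i)
  have hdp : ∀ i j : Fin n, ⁅dX F i, pT F j⁆ ∈ projSpan F n := fun i j => by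
    rw [lie_dX_pT]
    exact add_mem (xd_mem F _ _) (hite _ _ (sum_mem fun k _ => xd_mem F k k))
  have key : ∀ G : Witt F n, (∀ i j : Fin n, ⁅xd F i j, G⁆ ∈ projSpan F n) →
      (∀ i : Fin n, ⁅dX F i, G⁆ ∈ projSpan F n) → (∀ i : Fin n, ⁅pT F i, G⁆ ∈ projSpan F n) →
      ∀ A ∈ projSpan F n, ⁅A, G⁆ ∈ projSpan F n := by
    intro G h₁ h₂ h₃ A hA
    have := projSpan_induction F ((projSpan F n).comap (LieAlgebra.ad F (Witt F n) G))
      (fun i j => hskew _ _ (h₁ i j)) (fun i => hskew _ _ (h₂ i)) (fun i => hskew _ _ (h₃ i)) hA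
    exact hskew _ _ this
  apply hskew
  refine key D (fun i j => ?_) (fun i => ?_) (fun i => ?_) E hE
  · apply hskew
    refine key (xd F i j) (fun k l => ?_) (fun k => hskew _ _ (hxd i j k))
      (fun k => hskew _ _ (hxp i j k)) D hD
    rw [lie_xd_xd]
    exact sub_mem (hite _ _ (xd_mem F _ _)) (hite _ _ (xd_mem F _ _))
  · apply hskew
    refine key (dX F i) (fun k l => hxd k l i) (fun k => ?_) (fun k => hskew _ _ (hdp i k)) D hD
    rw [lie_dX_dX]
    exact zero_mem _
  · apply hskew
    refine key (pT F i) (fun k l => hxp k l i) (fun k => hdp k i) (fun k => ?_) D hD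
    rw [lie_pT_pT]
    exact zero_mem _

/-- The Lie algebra `L_{n+1} = ∑ F x_i ∂_{x_j} + ∑ F ∂_{x_i} + ∑ F p_i` of the projective group,
a Lie subalgebra of the Witt algebra (isomorphic to `sl(n+1)`). -/
def projAlg (F : Type*) [Field F] (n : ℕ) : LieSubalgebra F (Witt F n) where
  __ := projSpan F n
  lie_mem' := lie_mem_projSpan F

/-- The abelian Lie algebra `P = ∑ F p_i` of pseudo-translations. -/
def pseudoTrans (F : Type*) [Field F] (n : ℕ) : LieSubalgebra F (Witt F n) where
  __ := Submodule.span F (Set.range (pT F))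
  lie_mem' := by
    intro D E hD hE
    have : ⁅D, E⁆ = 0 := by
      induction hD, hE using Submodule.span_induction₂ with
      | mem_mem x y hx hy =>
        obtain ⟨i, rfl⟩ := hx
        obtain ⟨j, rfl⟩ := hy
        exact lie_pT_pT F i j
      | zero_left y hy => exact zero_lie y
      | zero_right x hx => exact lie_zero x
      | add_left x y z hx hy hz h₁ h₂ => rw [add_lie, h₁, h₂, add_zero]
      | add_right x y z hx hy hz h₁ h₂ => rw [lie_add, h₁, h₂, add_zero]
      | smul_left r x y hx hy h => rw [smul_lie, h, smul_zero]
      | smul_right r x y hx hy h => rw [lie_smul, h, smul_zero]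
    rw [this]
    exact zero_mem (Submodule.span F (Set.range (pT F)))

/-! ### The module `𝒜 ⊗ V` -/

theorem lie_matE_matE {F : Type*} [Field F] {n : ℕ} {V : Type*} [AddCommGroup V]
    [LieRingModule (Gl F n) V] (i j k l : Fin n) (v : V) :
    ⁅matE F i j, ⁅matE F k l, v⁆⁆ -
    ⁅matE F k l, ⁅matE F i j, v⁆⁆ =
      (if j = k then ⁅matE F i l, v⁆ else 0) - (if l = i then ⁅matE F k j, v⁆ else 0) := by
  rw [← lie_lie, Ring.lie_def, sub_lie]
  congr 1
  · split_ifs with h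
    · subst h
      simp [matE]
    · simp [matE, Matrix.single_mul_single_of_ne _ _ _ _ h]
  · split_ifs with h
    · subst h
      simp [matE]
    · simp [matE, Matrix.single_mul_single_of_ne _ _ _ _ h]

/-- A vector field is determined by its coefficients. -/
theorem act_eq_sum {F : Type*} [Field F] {n : ℕ} (D : Witt F n) (f : Poly F n) :
    act D f = ∑ k, act D (MvPolynomial.X k) * act (dX F k) f := by
  have h : D = ∑ k, act D (MvPolynomial.X k) • dX F k := by
    apply witt_ext
    intro m
    simp [map_sum, LinearMap.sum_apply, act_poly_smul, dX_X]
  conv_lhs => rw [h]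
  simp [map_sum, LinearMap.sum_apply, act_poly_smul]

theorem act_dX_act {F : Type*} [Field F] {n : ℕ} (D : Witt F n) (i : Fin n) (f : Poly F n) :
    act (dX F i) (act D f) = act D (act (dX F i) f) +
      ∑ k, act (dX F i) (act D (MvPolynomial.X k)) * act (dX F k) f := by
  have h := act_eq_sum ⁅dX F i, D⁆ f
  rw [act_lie] at h
  have h2 : ∀ k, act D (act (dX F i) (MvPolynomial.X k)) = 0 := by
    intro k
    rw [dX_X]
    split_ifs
    exacts [act_one D, map_zero _]
  simp only [act_lie, h2, sub_zero] at h
  rw [← h]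
  ring

theorem act_dX_lie {F : Type*} [Field F] {n : ℕ} (D E : Witt F n) (i j : Fin n) :
    act (dX F i) (act ⁅D, E⁆ (MvPolynomial.X j)) =
      act D (act (dX F i) (act E (MvPolynomial.X j))) -
        act E (act (dX F i) (act D (MvPolynomial.X j))) +
      ((∑ k, act (dX F i) (act D (MvPolynomial.X k)) *
          act (dX F k) (act E (MvPolynomial.X j))) -
        ∑ k, act (dX F i) (act E (MvPolynomial.X k)) *
          act (dX F k) (act D (MvPolynomial.X j))) := by
  rw [act_lie, map_sub, act_dX_act D i (act E (MvPolynomial.X j)),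
    act_dX_act E i (act D (MvPolynomial.X j))]
  abel

section Module

variable (F : Type*) [Field F] (n : ℕ) (V : Type*) [AddCommGroup V] [Module F V]

/-- The vector space `𝒜 ⊗ V`. -/
def ProjMod : Type _ := Poly F n ⊗[F] V

instance : AddCommGroup (ProjMod F n V) := inferInstanceAs (AddCommGroup (Poly F n ⊗[F] V))

instance : Module F (ProjMod F n V) := inferInstanceAs (Module F (Poly F n ⊗[F] V))

variable {F n V}

/-- The pure tensor `f ⊗ v` as an element of `𝒜 ⊗ V`. -/
def ten (f : Poly F n) (v : V) : ProjMod F n V := f ⊗ₜ[F] v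

theorem projMod_hom_ext {M : Type*} [AddCommGroup M] [Module F M] {g h : ProjMod F n V →ₗ[F] M}
    (H : ∀ f v, g (ten f v) = h (ten f v)) : g = h :=
  TensorProduct.ext' H

theorem ten_add (f : Poly F n) (v w : V) : ten f (v + w) = ten f v + ten f w :=
  TensorProduct.tmul_add f v w

theorem ten_sub (f : Poly F n) (v w : V) : ten f (v - w) = ten f v - ten f w :=
  TensorProduct.tmul_sub f v w

theorem ten_zero (f : Poly F n) : ten f (0 : V) = 0 := TensorProduct.tmul_zero V f

theorem add_ten (f g : Poly F n) (v : V) : ten (f + g) v = ten f v + ten g v :=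
  TensorProduct.add_tmul f g v

theorem sub_ten (f g : Poly F n) (v : V) : ten (f - g) v = ten f v - ten g v :=
  TensorProduct.sub_tmul f g v

theorem smul_ten (c : F) (f : Poly F n) (v : V) : ten (c • f) v = c • ten f v := rfl

theorem sum_ten {ι : Type*} (s : Finset ι) (f : ι → Poly F n) (v : V) :
    ten (∑ i ∈ s, f i) v = ∑ i ∈ s, ten (f i) v :=
  TensorProduct.sum_tmul s f v

theorem ten_ite (g : Poly F n) (p : Prop) [Decidable p] (w : V) :
    ten g (if p then w else 0) = if p then ten g w else 0 := by
  split_ifs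
  exacts [rfl, ten_zero g]

variable [LieRingModule (Gl F n) V]

theorem sum_swap_four {M : Type*} [AddCommMonoid M] {n : ℕ}
    (G : Fin n → Fin n → Fin n → Fin n → M) :
    ∑ k, ∑ l, ∑ i, ∑ j, G i j k l = ∑ k, ∑ l, ∑ i, ∑ j, G k l i j := by
  have h1 : ∀ k, ∑ l, ∑ i, ∑ j, G i j k l = ∑ i, ∑ j, ∑ l, G i j k l := by
    intro k
    rw [Finset.sum_comm]
    exact Finset.sum_congr rfl fun i _ => Finset.sum_comm
  simp only [h1]
  rw [Finset.sum_comm]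
  exact Finset.sum_congr rfl fun i _ => Finset.sum_comm

theorem quad_identity (a b : Fin n → Fin n → Poly F n) (f : Poly F n) (v : V) :
    (∑ k, ∑ l, ∑ i, ∑ j, ten (a i j * (b k l * f)) ⁅matE F i j, ⁅matE F k l, v⁆⁆) -
      (∑ k, ∑ l, ∑ i, ∑ j, ten (b i j * (a k l * f)) ⁅matE F i j, ⁅matE F k l, v⁆⁆) =
      ∑ i, ∑ j, ten (((∑ k, a i k * b k j) - ∑ k, b i k * a k j) * f) ⁅matE F i j, v⁆ := by
  have e1 : (∑ k, ∑ l, ∑ i, ∑ j, ten (b i j * (a k l * f)) ⁅matE F i j, ⁅matE F k l, v⁆⁆) =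
      ∑ k, ∑ l, ∑ i, ∑ j, ten (a i j * (b k l * f)) ⁅matE F k l, ⁅matE F i j, v⁆⁆ := by
    rw [sum_swap_four fun i j k l => ten (b i j * (a k l * f)) ⁅matE F i j, ⁅matE F k l, v⁆⁆]
    simp only [mul_left_comm]
  rw [e1]
  simp only [← Finset.sum_sub_distrib, ← ten_sub, lie_matE_matE]
  simp only [ten_sub, ten_ite, sub_mul, sub_ten, Finset.sum_mul, sum_ten, Finset.sum_sub_distrib]
  refine congrArg₂ (· - ·) ?_ ?_
  · have h : ∀ k l i : Fin n, (∑ j, if j = k then ten (a i j * (b k l * f)) ⁅matE F i l, v⁆ else 0)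
        = ten (a i k * b k l * f) ⁅matE F i l, v⁆ := by
      intro k l i
      rw [Finset.sum_ite_eq', if_pos (Finset.mem_univ _), mul_assoc]
    simp only [h]
    rw [Finset.sum_congr rfl fun k _ => Finset.sum_comm, Finset.sum_comm]
    exact Finset.sum_congr rfl fun i _ => Finset.sum_comm
  · have h : ∀ k l : Fin n,
        (∑ i, ∑ j, if l = i then ten (a i j * (b k l * f)) ⁅matE F k j, v⁆ else 0)
        = ∑ j, ten (b k l * a l j * f) ⁅matE F k j, v⁆ := by
      intro k l
      rw [Finset.sum_comm]
      refine Finset.sum_congr rfl fun j _ => ?_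
      rw [Finset.sum_ite_eq, if_pos (Finset.mem_univ _), mul_left_comm, mul_assoc]
    simp only [h]
    exact Finset.sum_congr rfl fun i _ => Finset.sum_comm

variable [LieModule F (Gl F n) V]

/-- The operator `π(D) = ∑_{i,j} ∂ᵢ(aⱼ) ⊗ E_{i,j} + D ⊗ Id_V` on `𝒜 ⊗ V` for `D = ∑ aⱼ ∂ⱼ`
(so that `aⱼ = D xⱼ`). -/
def piOp (D : Witt F n) : Module.End F (ProjMod F n V) :=
  ((∑ i, ∑ j, TensorProduct.map (LinearMap.mulLeft F (act (dX F i) (act D (MvPolynomial.X j))))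
      (LieModule.toEnd F (Gl F n) V (matE F i j))) +
    TensorProduct.map (act D) LinearMap.id : Poly F n ⊗[F] V →ₗ[F] Poly F n ⊗[F] V)

theorem piOp_ten (D : Witt F n) (f : Poly F n) (v : V) :
    piOp D (ten f v) =
      (∑ i, ∑ j, ten (act (dX F i) (act D (MvPolynomial.X j)) * f) ⁅matE F i j, v⁆) +
        ten (act D f) v := by
  change (((∑ i, ∑ j, TensorProduct.map
      (LinearMap.mulLeft F (act (dX F i) (act D (MvPolynomial.X j))))
      (LieModule.toEnd F (Gl F n) V (matE F i j))) +
    TensorProduct.map (act D) LinearMap.id : Poly F n ⊗[F] V →ₗ[F] Poly F n ⊗[F] V))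
      (f ⊗ₜ[F] v) = _
  simp only [LinearMap.add_apply, LinearMap.sum_apply, TensorProduct.map_tmul,
    LinearMap.mulLeft_apply, LieModule.toEnd_apply_apply, LinearMap.id_apply]
  rfl

theorem piOp_add (D E : Witt F n) : (piOp (D + E) : Module.End F (ProjMod F n V)) =
    piOp D + piOp E := by
  refine projMod_hom_ext fun f v => ?_
  simp only [LinearMap.add_apply, piOp_ten, map_add, add_mul, add_ten, Finset.sum_add_distrib]
  abel

theorem piOp_smul (c : F) (D : Witt F n) : (piOp (c • D) : Module.End F (ProjMod F n V)) =
    c • piOp D := by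
  refine projMod_hom_ext fun f v => ?_
  simp only [LinearMap.smul_apply, piOp_ten, map_smul, smul_mul_assoc, smul_ten, smul_add,
    Finset.smul_sum]

theorem piOp_piOp (A B : Witt F n) (f : Poly F n) (v : V) (p q : Fin n → Fin n → Poly F n)
    (hp : ∀ i j, act (dX F i) (act A (MvPolynomial.X j)) = p i j)
    (hq : ∀ i j, act (dX F i) (act B (MvPolynomial.X j)) = q i j) :
    piOp A (piOp B (ten f v)) =
      (∑ k, ∑ l, ∑ i, ∑ j, ten (p i j * (q k l * f)) ⁅matE F i j, ⁅matE F k l, v⁆⁆) +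
      ((∑ k, ∑ l, ten (act A (q k l) * f) ⁅matE F k l, v⁆) +
        ∑ k, ∑ l, ten (q k l * act A f) ⁅matE F k l, v⁆) +
      (∑ i, ∑ j, ten (p i j * act B f) ⁅matE F i j, v⁆) + ten (act A (act B f)) v := by
  have : ∀ k l, f * act A (q k l) = act A (q k l) * f := fun _ _ => mul_comm _ _
  simp only [piOp_ten, map_add, map_sum, hp, hq, Finset.sum_add_distrib, act_mul, add_ten, this]
  abel

theorem piOp_lie (D E : Witt F n) : (piOp ⁅D, E⁆ : Module.End F (ProjMod F n V)) =
    piOp D * piOp E - piOp E * piOp D := by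
  refine projMod_hom_ext fun f v => ?_
  rw [LinearMap.sub_apply, Module.End.mul_apply, Module.End.mul_apply,
    piOp_piOp D E f v _ _ (fun _ _ => rfl) (fun _ _ => rfl),
    piOp_piOp E D f v _ _ (fun _ _ => rfl) (fun _ _ => rfl), piOp_ten, act_lie, sub_ten]
  simp only [act_dX_lie]
  simp only [add_mul, add_ten, Finset.sum_add_distrib]
  rw [← quad_identity]
  simp only [sub_mul, sub_ten, Finset.sum_sub_distrib]
  abel

instance : LieRingModule (Witt F n) (ProjMod F n V) where
  bracket D m := piOp D m
  add_lie D E m := by rw [piOp_add, LinearMap.add_apply]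
  lie_add D _ _ := map_add (piOp D) _ _
  leibniz_lie D E m := by simp [piOp_lie]

instance : LieModule F (Witt F n) (ProjMod F n V) where
  smul_lie c D m := congrArg (fun φ : Module.End F (ProjMod F n V) => φ m) (piOp_smul c D)
  lie_smul _ D _ := map_smul (piOp D) _ _

/-- The homogeneous component `(𝒜 ⊗ V)_⟨j⟩`, spanned by the `x^c ⊗ v` with `|c| = j`. -/
def degPart (F : Type*) [Field F] (n : ℕ) (V : Type*) [AddCommGroup V] [Module F V] (j : ℕ) :
    Submodule F (ProjMod F n V) :=
  Submodule.span F {m | ∃ (c : Fin n →₀ ℕ) (v : V), ∑ i, c i = j ∧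
    m = ten (MvPolynomial.monomial c 1) v}

/-- `U(P)(1 ⊗ V)`: the span of the elements `u.(1 ⊗ v)` with `u` in the universal enveloping
algebra of `P` and `v ∈ V`. -/
def pseudoGen (F : Type*) [Field F] (n : ℕ) (V : Type*) [AddCommGroup V] [Module F V]
    [LieRingModule (Gl F n) V] [LieModule F (Gl F n) V] : Submodule F (ProjMod F n V) :=
  Submodule.span F {m | ∃ (u : UniversalEnvelopingAlgebra F (pseudoTrans F n)) (v : V),
    m = UniversalEnvelopingAlgebra.lift F
      (LieModule.toEnd F (pseudoTrans F n) (ProjMod F n V)) u (ten 1 v)}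

/-- The operator `p^l = p₁^{l₁} p₂^{l₂} ⋯ pₙ^{lₙ}` on `𝒜 ⊗ V`. -/
def pPow (F : Type*) [Field F] {n : ℕ} (V : Type*) [AddCommGroup V] [Module F V]
    [LieRingModule (Gl F n) V] [LieModule F (Gl F n) V] (l : Fin n → ℕ) :
    Module.End F (ProjMod F n V) :=
  (List.ofFn fun i => LieModule.toEnd F (Witt F n) (ProjMod F n V) (pT F i) ^ l i).prod

/-- The linear map `φ` on `𝒜 ⊗ V` given by `x^l ⊗ v ↦ p^l.(1 ⊗ v)`; its restriction to
`(𝒜 ⊗ V)_⟨j⟩` is `φ_j`. -/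
def phi (F : Type*) [Field F] (n : ℕ) (V : Type*) [AddCommGroup V] [Module F V]
    [LieRingModule (Gl F n) V] [LieModule F (Gl F n) V] : Module.End F (ProjMod F n V) :=
  (TensorProduct.lift ((MvPolynomial.basisMonomials (Fin n) F).constr F fun l =>
    pPow F V l ∘ₗ (TensorProduct.mk F (Poly F n) V 1 : V →ₗ[F] ProjMod F n V)) :
    Poly F n ⊗[F] V →ₗ[F] ProjMod F n V)

theorem phi_monomial (l : Fin n →₀ ℕ) (v : V) :
    phi F n V (ten (MvPolynomial.monomial l 1) v) = pPow F V l (ten 1 v) := by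
  have h : (MvPolynomial.basisMonomials (Fin n) F) l = MvPolynomial.monomial l 1 := by simp
  change ((MvPolynomial.basisMonomials (Fin n) F).constr F fun l =>
    pPow F V l ∘ₗ (TensorProduct.mk F (Poly F n) V 1 : V →ₗ[F] ProjMod F n V))
    (MvPolynomial.monomial l 1) v = _
  rw [← h, Module.Basis.constr_basis]
  rfl

/-- `ξ` is a maximal vector of weight `w` for `L̄ₙ = ∑ F x_i ∂_{x_j} ≅ gl(n)` acting on `𝒜 ⊗ V`:
it is nonzero, killed by all `x_i ∂_{x_j}` with `i < j`, and `x_i ∂_{x_i}` acts on it by `w_i`. -/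
def IsMaximalVector (w : Fin n → F) (ξ : ProjMod F n V) : Prop :=
  ξ ≠ 0 ∧ (∀ i j : Fin n, i < j → ⁅xd F i j, ξ⁆ = 0) ∧ ∀ i : Fin n, ⁅xd F i i, ξ⁆ = w i • ξ

end Module

/-! ### Highest weights, the index sets `I(μ, j)` and the scalars `q_c` -/

/-- The `gl(n)`-module `V` has a highest weight vector of weight `μ = (μ₁, …, μₙ)`. -/
def HasHighestWeight {F : Type*} [Field F] {n : ℕ} (V : Type*) [AddCommGroup V] [Module F V]
    [LieRingModule (Gl F n) V] (μ : Fin n → F) : Prop :=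
  ∃ v : V, v ≠ 0 ∧ (∀ i j : Fin n, i < j → ⁅matE F i j, v⁆ = 0) ∧ ∀ i : Fin n, ⁅matE F i i, v⁆ = μ i • v

/-- `I(μ, j)`: all `c ∈ ℕⁿ` with `|c| = j` and `c_{s+1} ≤ μ_s - μ_{s+1}` for `1 ≤ s < n`, the
latter meaning that `μ_s - μ_{s+1} - c_{s+1}` is a natural number. -/
def idxSet {F : Type*} [Field F] {n : ℕ} (μ : Fin n → F) (j : ℕ) : Set (Fin n → ℕ) :=
  {c | ∑ i, c i = j ∧
    ∀ s t : Fin n, (t : ℕ) = s + 1 → ∃ d : ℕ, μ s - μ t = ((c t + d : ℕ) : F)}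

/-- `q_c = ∏_{s=1}^n ∏_{i=1}^{c_s} (μ_s + |μ| - s + i)`. The index `s : Fin n` starts at `0`,
hence the shift. -/
def qScalar {F : Type*} [Field F] {n : ℕ} (μ : Fin n → F) (c : Fin n → ℕ) : F :=
  ∏ s : Fin n, ∏ i ∈ Finset.Icc 1 (c s), (μ s + ∑ k, μ k - ((s : ℕ) + 1 : F) + (i : F))

end

end GenProj

/-!
Let `E_{i,j}` denote the action of `x_i ∂_{x_j}` on `𝒜 ⊗ V` and `x_k` the multiplication by the
variable `x_k`. The proof rests on the following observations.

* The map `φ` satisfies `φ(1 ⊗ v) = 1 ⊗ v` and `φ x_k = p_k φ` (`phi_mulX`), where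
  `p_k = ∑_l x_l E_{k,l} + |μ| x_k` (`lie_pT`). Hence `φ` is a graded endomorphism of the
  `gl(n)`-module `𝒜 ⊗ V`, its image is `U(P)(1 ⊗ V)` (`pseudoGen_eq_range_phi`), and that image is
  an `L_{n+1}`-submodule. A nonzero `L_{n+1}`-submodule meets `1 ⊗ V`, because the `∂_{x_k}` act
  locally nilpotently, hence contains `1 ⊗ V` and then the image of `φ`. So irreducibility means
  that `φ` is surjective, or equivalently, the homogeneous components being finite-dimensional,
  injective.

* Let `f` be the lowest weight vector of the dual of `V` (`IsLowestDual`). Contraction with `f` maps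
  a vector of weight `μ + c` to a multiple of the monomial `x^c`, and it is injective on the vectors
  killed by the raising operators, as these generate the dual of `V` from `f`. So a maximal vector
  has weight `μ + c` with `c ∈ ℕⁿ` and is determined by its weight up to a scalar. The theory of
  `sl₂`, applied to `f`, gives `f ∘ E_{s,s+1}^{m+1} = 0` for `m = μ_s - μ_{s+1}`, so that
  `(x_s ∂_{x_{s+1}})^{m+1}` kills `x^c`, that is, `c_{s+1} ≤ m`. Thus the weights of the maximal
  vectors are all among `μ + c` with `c ∈ I(μ, |c|)` (`IsLowestDual.exists_mem_idxSet`).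

* Conversely, the set of all these `c` is closed under decreasing an entry, so maximal vectors can be
  built one step at a time (`IsLowestDual.exists_isMaximalVector_succ`). Let `ξ` be maximal of weight
  `λ = μ + c` with `φ(ξ) = q_c ξ`, and let `Ω` be the Casimir operator of `gl(n)`. Then
  `(Ω - γ_t) x_t ξ = 2 ∑_{l < t} E_{t,l} x_l ξ` for suitable scalars `γ_t`
  (`casimir_mulX_maximal`), so `η = ∏_{t < s} (Ω - γ_t) x_s ξ` is killed by the raising operators
  and by `Ω - γ_s`. The coefficient of `x^{c + e_s}` in its contraction with `f` is a product of
  explicit factors (`triangular_recursion`), none of which vanishes if `c + e_s ∈ I(μ, |c| + 1)`;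
  thus `η` is maximal. Since `2 p_k` is the commutator of `Ω` and `x_k` up to a multiple of `x_k`,
  and since `φ` commutes with `Ω`, the vector `η` is an eigenvector of `φ`, with eigenvalue
  `q_{c + e_s}`.

* The kernel of `φ` is a `gl(n)`-submodule. If it is nonzero, it contains a maximal vector
  (`HasHighestWeight.exists_isMaximalVector_mem`), whose weight is `μ + c` for some `c ∈ I(μ, j)` with
  `q_c = 0`. So `φ` is injective if and only if no `q_c` vanishes (`phi_injective_iff`).
-/

namespace GenProj

noncomputable section

/-! ### The operators of `L_{n+1}` on `𝒜 ⊗ V` -/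

section Operators

variable {F : Type*} [Field F] {n : ℕ} {V : Type*} [AddCommGroup V] [Module F V]

theorem zero_ten (v : V) : ten (0 : Poly F n) v = 0 := TensorProduct.zero_tmul _ v

theorem ten_smul (c : F) (f : Poly F n) (v : V) : ten f (c • v) = c • ten f v :=
  TensorProduct.tmul_smul c f v

theorem ten_sum {ι : Type*} (s : Finset ι) (f : Poly F n) (v : ι → V) :
    ten f (∑ i ∈ s, v i) = ∑ i ∈ s, ten f (v i) :=
  TensorProduct.tmul_sum f s v

@[elab_as_elim]
theorem projMod_induction {p : ProjMod F n V → Prop} (m : ProjMod F n V) (zero : p 0)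
    (ten : ∀ f v, p (ten f v)) (add : ∀ a b, p a → p b → p (a + b)) : p m :=
  TensorProduct.induction_on m zero ten add

/-- Multiplication by the variable `x_k` on the first factor of `𝒜 ⊗ V`. -/
def mulX (k : Fin n) : Module.End F (ProjMod F n V) :=
  (TensorProduct.map (LinearMap.mulLeft F (MvPolynomial.X k)) LinearMap.id :
    Poly F n ⊗[F] V →ₗ[F] Poly F n ⊗[F] V)

theorem mulX_ten (k : Fin n) (f : Poly F n) (v : V) :
    mulX k (ten f v) = ten (MvPolynomial.X k * f) v := rfl

/-- A linear map `g : V → F` contracts `𝒜 ⊗ V` to `𝒜`. -/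
def contr (g : V →ₗ[F] F) : ProjMod F n V →ₗ[F] Poly F n :=
  ((TensorProduct.rid F (Poly F n)).toLinearMap ∘ₗ TensorProduct.map LinearMap.id g :
    Poly F n ⊗[F] V →ₗ[F] Poly F n)

theorem contr_ten (g : V →ₗ[F] F) (f : Poly F n) (v : V) : contr g (ten f v) = g v • f := rfl

theorem contr_add (g h : V →ₗ[F] F) (m : ProjMod F n V) :
    contr (g + h) m = contr g m + contr h m := by
  induction m using projMod_induction with
  | zero => simp
  | ten p v => simp [contr_ten, add_smul]
  | add a b ha hb => rw [map_add, map_add, map_add, ha, hb]; abel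

theorem contr_smul (c : F) (g : V →ₗ[F] F) (m : ProjMod F n V) :
    contr (c • g) m = c • contr g m := by
  induction m using projMod_induction with
  | zero => simp
  | ten p v => simp [contr_ten, mul_smul]
  | add a b ha hb => rw [map_add, map_add, smul_add, ha, hb]

theorem contr_mulX (g : V →ₗ[F] F) (k : Fin n) (m : ProjMod F n V) :
    contr g (mulX k m) = MvPolynomial.X k * contr g m := by
  have : (contr g ∘ₗ mulX k : ProjMod F n V →ₗ[F] Poly F n) =
      LinearMap.mulLeft F (MvPolynomial.X k) ∘ₗ contr g :=
    projMod_hom_ext fun f v => by simp [mulX_ten, contr_ten]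
  exact LinearMap.congr_fun this m

/-- A subspace containing `1 ⊗ V` and stable under the multiplications by variables is the
whole module. -/
theorem eq_top_of_mulX {N : Submodule F (ProjMod F n V)} (h1 : ∀ v : V, ten 1 v ∈ N)
    (hX : ∀ k, ∀ m ∈ N, mulX k m ∈ N) : N = ⊤ := by
  have key : ∀ (f : Poly F n) (v : V), ten f v ∈ N := by
    intro f v
    induction f using MvPolynomial.induction_on with
    | C a =>
      have : ten (MvPolynomial.C a : Poly F n) v = a • ten 1 v := by
        rw [← smul_ten, MvPolynomial.smul_eq_C_mul, mul_one]
      rw [this]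
      exact N.smul_mem _ (h1 v)
    | add p q hp hq => rw [add_ten]; exact add_mem hp hq
    | mul_X p k hp => rw [mul_comm, ← mulX_ten]; exact hX k _ hp
  refine eq_top_iff.2 fun m _ => ?_
  induction m using projMod_induction with
  | zero => exact zero_mem N
  | ten f v => exact key f v
  | add p q hp hq => exact add_mem (hp trivial) (hq trivial)

/-- Coordinates of an element of `𝒜 ⊗ V` with respect to a basis of `V`. -/
theorem sum_ten_contr {ι : Type*} [Fintype ι] (b : Module.Basis ι F V) (m : ProjMod F n V) :
    ∑ i, ten (contr (b.coord i) m) (b i) = m := by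
  induction m using projMod_induction with
  | zero => simp [zero_ten]
  | ten f v =>
    simp only [contr_ten, smul_ten, ← ten_smul]
    rw [← ten_sum]
    congr 1
    exact b.sum_repr v
  | add p q hp hq =>
    simp only [map_add, add_ten, Finset.sum_add_distrib, hp, hq]

/-- An element all of whose contractions vanish is zero. -/
theorem eq_zero_of_contr [FiniteDimensional F V] {m : ProjMod F n V}
    (h : ∀ g : V →ₗ[F] F, contr g m = 0) : m = 0 := by
  rw [← sum_ten_contr (Module.finBasis F V) m]
  simp [h, zero_ten]

theorem ten_one_ne_zero {v : V} (hv : v ≠ 0) : ten (1 : Poly F n) v ≠ 0 := by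
  intro h
  refine hv ((Module.forall_dual_apply_eq_zero_iff F v).1 fun g => ?_)
  have := congrArg (contr g) h
  rw [contr_ten, map_zero] at this
  simpa using this

variable [LieRingModule (Gl F n) V] [LieModule F (Gl F n) V]

theorem lie_witt_def (D : Witt F n) (m : ProjMod F n V) : ⁅D, m⁆ = piOp D m := rfl

theorem lie_dX_ten (k : Fin n) (f : Poly F n) (v : V) :
    ⁅dX F k, ten f v⁆ = ten (MvPolynomial.pderiv k f) v := by
  rw [lie_witt_def, piOp_ten]
  have : ∀ i j, act (dX F i) (act (dX F k) (MvPolynomial.X j)) = 0 := by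
    intro i j
    rw [dX_X]
    split_ifs
    exacts [act_one _, map_zero _]
  simp only [this, zero_mul]
  simp only [zero_ten, Finset.sum_const_zero, zero_add]
  rfl

theorem lie_xd_ten (i j : Fin n) (f : Poly F n) (v : V) :
    ⁅xd F i j, ten f v⁆ = ten f ⁅matE F i j, v⁆ + ten (act (xd F i j) f) v := by
  rw [lie_witt_def, piOp_ten]
  congr 1
  have : ∀ a b, ten (act (dX F a) (act (xd F i j) (MvPolynomial.X b)) * f) ⁅matE F a b, v⁆ =
      if a = i then (if b = j then ten f ⁅matE F a b, v⁆ else 0) else 0 := by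
    intro a b
    rw [xd_X]
    split_ifs <;> simp_all [dX_X, zero_ten, eq_comm]
  simp [this]

theorem lie_xd_ten_one (i j : Fin n) (v : V) :
    ⁅xd F i j, ten (1 : Poly F n) v⁆ = ten 1 ⁅matE F i j, v⁆ := by
  rw [lie_xd_ten, act_one, zero_ten, add_zero]

theorem lie_xd_mulX (i j k : Fin n) (m : ProjMod F n V) :
    ⁅xd F i j, mulX k m⁆ = mulX k ⁅xd F i j, m⁆ + if j = k then mulX i m else 0 := by
  have : (piOp (xd F i j) ∘ₗ mulX k : ProjMod F n V →ₗ[F] ProjMod F n V) =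
      mulX k ∘ₗ piOp (xd F i j) + if j = k then mulX i else 0 := by
    refine projMod_hom_ext fun f v => ?_
    have h := lie_xd_ten i j (MvPolynomial.X k * f) v
    have h' := lie_xd_ten i j f v
    rw [lie_witt_def] at h h'
    simp only [LinearMap.comp_apply, LinearMap.add_apply, mulX_ten, h, h', map_add, act_mul,
      add_ten, xd_X]
    split_ifs
    · rw [mulX_ten, mul_comm f, add_assoc]
    · rw [mul_zero, zero_ten]; simp
  have h := LinearMap.congr_fun this m
  simp only [LinearMap.comp_apply, LinearMap.add_apply] at h
  rw [lie_witt_def, h, lie_witt_def]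
  split_ifs <;> rfl

theorem lie_dX_mulX (i k : Fin n) (m : ProjMod F n V) :
    ⁅dX F i, mulX k m⁆ = mulX k ⁅dX F i, m⁆ + if i = k then m else 0 := by
  have : (piOp (dX F i) ∘ₗ mulX k : ProjMod F n V →ₗ[F] ProjMod F n V) =
      mulX k ∘ₗ piOp (dX F i) + if i = k then LinearMap.id else 0 := by
    refine projMod_hom_ext fun f v => ?_
    have h := lie_dX_ten i (MvPolynomial.X k * f) v
    have h' := lie_dX_ten i f v
    rw [lie_witt_def] at h h'
    simp only [LinearMap.comp_apply, LinearMap.add_apply, mulX_ten, h, h',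
      MvPolynomial.pderiv_mul, add_ten, MvPolynomial.pderiv_X]
    split_ifs with hik
    · subst hik
      simp [add_comm]
    · simp [Ne.symm hik, zero_ten]
  have h := LinearMap.congr_fun this m
  simp only [LinearMap.comp_apply, LinearMap.add_apply] at h
  rw [lie_witt_def, h, lie_witt_def]
  split_ifs <;> rfl

theorem contr_lie_dX (g : V →ₗ[F] F) (k : Fin n) (m : ProjMod F n V) :
    contr g ⁅dX F k, m⁆ = MvPolynomial.pderiv k (contr g m) := by
  have : (contr g ∘ₗ piOp (dX F k) : ProjMod F n V →ₗ[F] Poly F n) =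
      (MvPolynomial.pderiv k).toLinearMap ∘ₗ contr g :=
    projMod_hom_ext fun f v => by
      rw [LinearMap.comp_apply, ← lie_witt_def, lie_dX_ten]
      simp [contr_ten]
  exact LinearMap.congr_fun this m

/-- Contraction is equivariant up to the action of `gl(n)` on the dual of `V`. -/
theorem contr_lie_xd (g : Module.Dual F V) (i j : Fin n) (m : ProjMod F n V) :
    contr g ⁅xd F i j, m⁆ = act (xd F i j) (contr g m) - contr ⁅matE F i j, g⁆ m := by
  have : (contr g ∘ₗ piOp (xd F i j) : ProjMod F n V →ₗ[F] Poly F n) =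
      act (xd F i j) ∘ₗ contr g - contr ⁅matE F i j, g⁆ :=
    projMod_hom_ext fun f v => by
      rw [LinearMap.comp_apply, ← lie_witt_def, lie_xd_ten]
      simp [contr_ten, add_comm]
  exact LinearMap.congr_fun this m

/-- If the identity matrix acts on `V` by `c`, then `p_k = ∑ₗ x_l (x_k ∂_l) + c x_k` on
`𝒜 ⊗ V`, where `x_k ∂_l` stands for its action on `𝒜 ⊗ V`. -/
theorem lie_pT (c : F) (hc : ∀ v : V, ∑ i : Fin n, ⁅matE F i i, v⁆ = c • v) (k : Fin n)
    (m : ProjMod F n V) :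
    ⁅pT F k, m⁆ = ∑ l, mulX l ⁅xd F k l, m⁆ + c • mulX k m := by
  have : (piOp (pT F k) : ProjMod F n V →ₗ[F] ProjMod F n V) =
      ∑ l, mulX l ∘ₗ piOp (xd F k l) + c • mulX k := by
    refine projMod_hom_ext fun f v => ?_
    have h : ∀ l, piOp (xd F k l) (ten f v) =
        ten f ⁅matE F k l, v⁆ + ten (act (xd F k l) f) v := fun l => lie_xd_ten k l f v
    have h1 : ∀ a b, ten (act (dX F a) (act (pT F k) (MvPolynomial.X b)) * f) ⁅matE F a b, v⁆ =
        (if a = b then ten (MvPolynomial.X k * f) ⁅matE F a b, v⁆ else 0) +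
        (if a = k then ten (MvPolynomial.X b * f) ⁅matE F a b, v⁆ else 0) := by
      intro a b
      rw [pT_X, act_mul, dX_X, dX_X]
      split_ifs <;> simp [zero_ten, add_ten, add_mul]
    have h2 : act (pT F k) f = ∑ l, MvPolynomial.X l * act (xd F k l) f := by
      rw [pT, act_poly_smul, map_sum, LinearMap.sum_apply, Finset.mul_sum]
      refine Finset.sum_congr rfl fun l _ => ?_
      rw [xd, xd, act_poly_smul, act_poly_smul, mul_left_comm]
    rw [piOp_ten]
    simp only [LinearMap.add_apply, LinearMap.sum_apply, LinearMap.comp_apply, h,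
      LinearMap.smul_apply, mulX_ten, map_add, h1, h2, Finset.sum_add_distrib, sum_ten]
    have h3 : ∑ a : Fin n, ten (MvPolynomial.X k * f) ⁅matE F a a, v⁆ =
        c • ten (MvPolynomial.X k * f) v := by
      rw [← ten_smul, ← hc, ten_sum]
    simp only [Finset.sum_ite_eq, Finset.mem_univ, if_true, h3]
    have h4 : ∑ a, ∑ b, (if a = k then ten (MvPolynomial.X b * f) ⁅matE F a b, v⁆ else 0) =
        ∑ b, ten (MvPolynomial.X b * f) ⁅matE F k b, v⁆ := by
      rw [Finset.sum_comm]
      simp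
    rw [h4]
    abel
  have h := LinearMap.congr_fun this m
  simp only [LinearMap.add_apply, LinearMap.sum_apply, LinearMap.comp_apply,
    LinearMap.smul_apply] at h
  exact h

end Operators

/-! ### Highest weight vectors of `gl(n)`-modules -/

section Words

variable {F : Type*} [Field F] {n : ℕ} {M : Type*} [AddCommGroup M] [Module F M]
  [LieRingModule (Gl F n) M]

/-- `IsWord F r m₀ y`: the vector `y` is obtained from `m₀` by applying successively matrix units
`E_{i,k}` with `r i k`. -/
inductive IsWord (F : Type*) [Field F] {n : ℕ} {M : Type*} [AddCommGroup M] [Module F M]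
    [LieRingModule (Gl F n) M] (r : Fin n → Fin n → Prop) (m₀ : M) : M → Prop
  | base : IsWord F r m₀ m₀
  | step {i k : Fin n} (h : r i k) {y : M} (hy : IsWord F r m₀ y) : IsWord F r m₀ ⁅matE F i k, y⁆

omit [Module F M] in
theorem lie_lie_matE (i j k l : Fin n) (v : M) :
    ⁅matE F i j, ⁅matE F k l, v⁆⁆ = ⁅matE F k l, ⁅matE F i j, v⁆⁆ +
      ((if j = k then ⁅matE F i l, v⁆ else 0) - (if l = i then ⁅matE F k j, v⁆ else 0)) := by
  rw [← lie_matE_matE]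
  abel

variable [LieModule F (Gl F n) M]

/-- A subspace stable under the matrix units is a `gl(n)`-submodule. -/
def lieSubmoduleOfMatE (N : Submodule F M) (h : ∀ i k : Fin n, ∀ m ∈ N, ⁅matE F i k, m⁆ ∈ N) :
    LieSubmodule F (Gl F n) M where
  __ := N
  lie_mem {x m} hm := by
    change ⁅x, m⁆ ∈ N
    rw [Matrix.matrix_eq_sum_single x, sum_lie]
    refine sum_mem fun i _ => ?_
    rw [sum_lie]
    refine sum_mem fun j _ => ?_
    have : Matrix.single i j (x i j) = x i j • matE F i j := by simp [matE]
    rw [this, smul_lie]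
    exact N.smul_mem _ (h i j m hm)

theorem eq_top_of_matE [LieModule.IsIrreducible F (Gl F n) M] {N : Submodule F M}
    (h : ∀ i k : Fin n, ∀ m ∈ N, ⁅matE F i k, m⁆ ∈ N) {m : M} (hm : m ∈ N) (h0 : m ≠ 0) :
    N = ⊤ := by
  have h1 : lieSubmoduleOfMatE N h ≠ ⊥ := by
    intro h2
    have : m ∈ lieSubmoduleOfMatE N h := hm
    rw [h2] at this
    exact h0 (by simpa using this)
  have h2 := (IsSimpleOrder.eq_bot_or_eq_top (lieSubmoduleOfMatE N h)).resolve_left h1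
  refine eq_top_iff.2 fun x _ => ?_
  have : x ∈ lieSubmoduleOfMatE N h := by rw [h2]; trivial
  exact this

/-- If the matrix units outside of `r` act on `m₀` by scalars, then the span of the words in the
matrix units from `r` is stable under all of `gl(n)`. -/
theorem lie_mem_span_isWord {r : Fin n → Fin n → Prop} {m₀ : M}
    (h0 : ∀ i k : Fin n, ¬ r i k → ∃ c : F, ⁅matE F i k, m₀⁆ = c • m₀) (i k : Fin n) :
    ∀ m ∈ Submodule.span F {y | IsWord F r m₀ y},
      ⁅matE F i k, m⁆ ∈ Submodule.span F {y | IsWord F r m₀ y} := by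
  set N := Submodule.span F {y | IsWord F r m₀ y} with hN
  have hext : ∀ i k, (∀ y, IsWord F r m₀ y → ⁅matE F i k, y⁆ ∈ N) →
      ∀ m ∈ N, ⁅matE F i k, m⁆ ∈ N := fun i k h =>
    (Submodule.span_le (p := N.comap (LieModule.toEnd F (Gl F n) M (matE F i k)))).2 h
  refine hext i k fun y hy => ?_
  induction hy generalizing i k with
  | base =>
    by_cases h : r i k
    · exact Submodule.subset_span (IsWord.step h IsWord.base)
    · obtain ⟨c, hc⟩ := h0 i k h
      rw [hc]
      exact N.smul_mem _ (Submodule.subset_span IsWord.base)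
  | @step a b hab y hy ih =>
    have hite : ∀ (p : Prop) [Decidable p] (c d : Fin n),
        (if p then ⁅matE F c d, y⁆ else 0) ∈ N := by
      intro p _ c d
      split_ifs
      exacts [ih c d, zero_mem _]
    rw [lie_lie_matE]
    refine add_mem (hext a b (fun z hz => Submodule.subset_span (IsWord.step hab hz)) _ (ih i k)) ?_
    exact sub_mem (hite _ _ _) (hite _ _ _)

/-- The functional `∑ i λ_i` on weights; the operators `E_{i,k}` with `k < i` raise it. -/
def ht (w : Fin n → F) : F := ∑ i : Fin n, ((i : ℕ) : F) * w i

theorem ht_add_single (w : Fin n → F) (i : Fin n) (c : F) :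
    ht (w + Pi.single i c) = ht w + ((i : ℕ) : F) * c := by
  simp [ht, mul_add, Finset.sum_add_distrib, Pi.single_apply]

theorem lie_matE_weight {w : Fin n → F} {y : M} (hy : ∀ a : Fin n, ⁅matE F a a, y⁆ = w a • y)
    (i k a : Fin n) :
    ⁅matE F a a, ⁅matE F i k, y⁆⁆ =
      (w + Pi.single i 1 + Pi.single k (-1) : Fin n → F) a • ⁅matE F i k, y⁆ := by
  rw [lie_lie_matE, hy, lie_smul]
  simp only [Pi.add_apply, Pi.single_apply, add_smul, eq_comm (a := k)]
  split_ifs with h1 h2 h2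
  · subst h1; subst h2; simp
  · subst h1; simp
  · subst h2; simp [sub_eq_add_neg]
  · simp

/-- The lowering operators move a weight vector to one of strictly larger height. -/
theorem exists_weight_lower {μ w : Fin n → F} {d : ℕ} {y : M}
    (hy : ∀ a : Fin n, ⁅matE F a a, y⁆ = w a • y) (hd : ht w = ht μ + d) {i k : Fin n}
    (h : k < i) :
    ∃ (w' : Fin n → F) (d' : ℕ), (∀ a : Fin n, ⁅matE F a a, ⁅matE F i k, y⁆⁆ =
      w' a • ⁅matE F i k, y⁆) ∧ ht w' = ht μ + d' ∧ 0 < d' := by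
  refine ⟨_, d + (i - k : ℕ), lie_matE_weight hy i k, ?_, by omega⟩
  rw [ht_add_single, ht_add_single, hd]
  have : ((i : ℕ) : F) = ((i - k : ℕ) : F) + ((k : ℕ) : F) := by
    rw [← Nat.cast_add]; congr 1; omega
  rw [this]
  push_cast
  ring

/-- A word in the lowering operators on a vector of weight `μ` is a weight vector, of larger
height unless the word is empty. -/
theorem IsWord.exists_weight {μ : Fin n → F} {v : M}
    (hv : ∀ a : Fin n, ⁅matE F a a, v⁆ = μ a • v) {y : M}
    (hy : IsWord F (fun i k : Fin n => k < i) v y) :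
    ∃ (w : Fin n → F) (d : ℕ), (∀ a : Fin n, ⁅matE F a a, y⁆ = w a • y) ∧ ht w = ht μ + d ∧
      (y = v ∨ 0 < d) := by
  induction hy with
  | base => exact ⟨μ, 0, hv, by simp, Or.inl rfl⟩
  | step h hy ih =>
    obtain ⟨w, d, h1, h2, -⟩ := ih
    obtain ⟨w', d', h3, h4, h5⟩ := exists_weight_lower h1 h2 h
    exact ⟨w', d', h3, h4, Or.inr h5⟩

end Words

section HighestWeight

variable {F : Type*} [Field F] [CharZero F] {n : ℕ} {V : Type*} [AddCommGroup V] [Module F V]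
  [LieRingModule (Gl F n) V] [LieModule F (Gl F n) V] [LieModule.IsIrreducible F (Gl F n) V]
  {μ : Fin n → F} {v : V}

omit [CharZero F] in
theorem span_isWord_eq_top (hv0 : v ≠ 0) (hv1 : ∀ i j : Fin n, i < j → ⁅matE F i j, v⁆ = 0)
    (hv2 : ∀ i : Fin n, ⁅matE F i i, v⁆ = μ i • v) :
    Submodule.span F {y | IsWord F (fun i k : Fin n => k < i) v y} = ⊤ := by
  refine eq_top_of_matE (lie_mem_span_isWord fun i k hik => ?_)
    (Submodule.subset_span IsWord.base) hv0
  rcases eq_or_lt_of_le (not_lt.1 hik) with rfl | h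
  · exact ⟨_, hv2 i⟩
  · exact ⟨0, by rw [hv1 i k h, zero_smul]⟩

/-- `f : V → F` is a lowest weight vector of weight `-μ` in the dual of `V`. -/
structure IsLowestDual (μ : Fin n → F) (f : Module.Dual F V) : Prop where
  ne_zero : f ≠ 0
  lower : ∀ i j : Fin n, j < i → ⁅matE F i j, f⁆ = 0
  weight : ∀ i : Fin n, ⁅matE F i i, f⁆ = (-μ i) • f

/-- The functional vanishing on all weight vectors of weight other than `μ` is a lowest weight
vector of the dual. -/
theorem exists_isLowestDual (hv0 : v ≠ 0) (hv1 : ∀ i j : Fin n, i < j → ⁅matE F i j, v⁆ = 0)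
    (hv2 : ∀ i : Fin n, ⁅matE F i i, v⁆ = μ i • v) : ∃ f : Module.Dual F V, IsLowestDual μ f := by
  set S : Set V := {y | ∃ (w : Fin n → F) (k : ℕ), (∀ a : Fin n, ⁅matE F a a, y⁆ = w a • y) ∧
    ht w = ht μ + k ∧ 0 < k} with hS
  let H : Module.End F V := ∑ i : Fin n, ((i : ℕ) : F) • LieModule.toEnd F (Gl F n) V (matE F i i)
  have hH : ∀ (w : Fin n → F) (y : V), (∀ a : Fin n, ⁅matE F a a, y⁆ = w a • y) →
      y ∈ H.eigenspace (ht w) := by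
    intro w y hy
    rw [Module.End.mem_eigenspace_iff]
    simp [H, LinearMap.sum_apply, hy, ht, Finset.sum_smul, smul_smul]
  have hvS : v ∉ Submodule.span F S := by
    intro hmem
    have h1 : Submodule.span F S ≤ ⨆ ν, ⨆ (_ : ν ≠ ht μ), H.eigenspace ν := by
      rw [Submodule.span_le]
      rintro y ⟨w, k, h2, h3, h4⟩
      refine Submodule.mem_iSup_of_mem (ht w) (Submodule.mem_iSup_of_mem ?_ (hH w y h2))
      rw [h3]
      simpa using h4.ne'
    have h2 := (H.eigenspaces_iSupIndep (ht μ)).le_bot ⟨hH μ v hv2, h1 hmem⟩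
    exact hv0 (by simpa using h2)
  obtain ⟨f, hf1, hf2⟩ := Submodule.exists_dual_map_eq_bot_of_notMem hvS inferInstance
  have hfS : ∀ y ∈ S, f y = 0 := by
    intro y hy
    have : f y ∈ (Submodule.span F S).map f := ⟨y, Submodule.subset_span hy, rfl⟩
    rw [hf2] at this
    simpa using this
  have htop := span_isWord_eq_top hv0 hv1 hv2
  have hlow : ∀ i j : Fin n, j < i → ⁅matE F i j, f⁆ = 0 := by
    intro i j hij
    refine LinearMap.ext_on htop fun y hy => ?_
    obtain ⟨w, d, h1, h2, -⟩ := IsWord.exists_weight hv2 hy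
    simp [hfS _ (exists_weight_lower h1 h2 hij)]
  have hwt : ∀ i : Fin n, ⁅matE F i i, f⁆ = (-μ i) • f := by
    intro i
    refine LinearMap.ext_on htop fun y hy => ?_
    obtain ⟨w, k, h1, h2, h3⟩ := IsWord.exists_weight hv2 hy
    rcases h3 with rfl | h3
    · simp [hv2]
    · simp [h1, hfS y ⟨w, k, h1, h2, h3⟩]
  exact ⟨f, fun h => hf1 (by rw [h, LinearMap.zero_apply]), hlow, hwt⟩

omit [CharZero F] in
/-- The dual of `V` is generated from its lowest weight vector by the raising operators. -/
theorem IsLowestDual.span_isWord_eq_top [FiniteDimensional F V] {f : Module.Dual F V}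
    (hf : IsLowestDual μ f) :
    Submodule.span F {g : Module.Dual F V | IsWord F (fun i k : Fin n => i < k) f g} = ⊤ := by
  set Y := Submodule.span F {g : Module.Dual F V | IsWord F (fun i k : Fin n => i < k) f g} with hY
  have hst := lie_mem_span_isWord (F := F) (r := fun i k => i < k) (m₀ := f) fun i k hik => by
    rcases eq_or_lt_of_le (not_lt.1 hik) with rfl | h
    · exact ⟨_, hf.weight k⟩
    · exact ⟨0, by rw [hf.lower i k h, zero_smul]⟩
  have hfY : f ∈ Y := Submodule.subset_span IsWord.base
  have hco : Y.dualCoannihilator = ⊥ := by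
    by_contra hne
    obtain ⟨x, hx, hx0⟩ := (Submodule.ne_bot_iff _).1 hne
    have htop : Y.dualCoannihilator = ⊤ := by
      refine eq_top_of_matE (F := F) (n := n) (fun i k m hm => ?_) hx hx0
      rw [Submodule.mem_dualCoannihilator] at hm ⊢
      intro g hg
      have := hm _ (hst i k g hg)
      simpa using this
    apply hf.ne_zero
    ext y
    have : y ∈ Y.dualCoannihilator := by rw [htop]; trivial
    exact (Submodule.mem_dualCoannihilator _).1 this f hfY
  have := Subspace.dualCoannihilator_dualAnnihilator_eq (W := Y)
  rw [← this, hco, Submodule.dualAnnihilator_bot]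

end HighestWeight

/-! ### Contraction of maximal vectors with the lowest weight functional -/

section Poly

variable {F : Type*} [Field F] {n : ℕ}

open MvPolynomial in
theorem act_xd (i j : Fin n) (p : Poly F n) : act (xd F i j) p = X i * pderiv j p := rfl

open MvPolynomial in
theorem coeff_act_xd (i j : Fin n) (p : Poly F n) (m : Fin n →₀ ℕ) :
    coeff (Finsupp.single i 1 + m) (act (xd F i j) p) =
      (m j + 1) * coeff (m + Finsupp.single j 1) p := by
  rw [act_xd, coeff_X_mul, coeff_pderiv, mul_comm]

open MvPolynomial in
theorem coeff_act_xd_self (i : Fin n) (p : Poly F n) (m : Fin n →₀ ℕ) :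
    coeff m (act (xd F i i) p) = m i * coeff m p := by
  induction p using MvPolynomial.induction_on' with
  | add p q hp hq => rw [map_add, coeff_add, coeff_add, hp, hq, mul_add]
  | monomial c a =>
    rw [act_xd, X_mul_pderiv_monomial, coeff_smul, coeff_monomial]
    split_ifs with h
    · subst h; simp
    · simp

open MvPolynomial in
theorem act_xd_pow_monomial_ne_zero [CharZero F] {s t : Fin n} (hst : s ≠ t) (k : ℕ)
    (c : Fin n →₀ ℕ) (a : F) (ha : a ≠ 0) (hk : k ≤ c t) :
    (act (xd F s t) ^ k) (monomial c a) ≠ 0 := by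
  induction k generalizing c a with
  | zero => simpa using ha
  | succ k ih =>
    rw [pow_succ, Module.End.mul_apply, act_xd, pderiv_monomial, X, monomial_mul]
    refine ih _ _ ?_ ?_
    · rw [one_mul]
      exact mul_ne_zero ha (Nat.cast_ne_zero.2 (by omega))
    · simp [hst]
      omega

end Poly

section Maximal

variable {F : Type*} [Field F] {n : ℕ} {V : Type*} [AddCommGroup V] [Module F V]
  [FiniteDimensional F V] [LieRingModule (Gl F n) V] [LieModule F (Gl F n) V]
  {μ : Fin n → F} {f : Module.Dual F V}

/-- A vector killed by the raising operators is determined by its contraction with the lowest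
weight functional, since the raising operators generate the dual of `V` from the latter. -/
theorem IsLowestDual.eq_zero_of_contr [LieModule.IsIrreducible F (Gl F n) V]
    (hf : IsLowestDual μ f) {ξ : ProjMod F n V}
    (hξ : ∀ i j : Fin n, i < j → ⁅xd F i j, ξ⁆ = 0) (h0 : contr f ξ = 0) : ξ = 0 := by
  refine GenProj.eq_zero_of_contr fun g => ?_
  have hg :
      g ∈ Submodule.span F {g : Module.Dual F V | IsWord F (fun i k : Fin n => i < k) f g} := by
    rw [hf.span_isWord_eq_top]
    trivial
  induction hg using Submodule.span_induction with
  | mem g hg =>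
    induction hg with
    | base => exact h0
    | @step i k h g hg ih =>
      have := contr_lie_xd g i k ξ
      rw [hξ i k h, ih, map_zero, map_zero, zero_sub, eq_comm, neg_eq_zero] at this
      exact this
  | zero => simpa using contr_smul (0 : F) 0 ξ
  | add g h _ _ hg hh => rw [contr_add, hg, hh, add_zero]
  | smul c g _ hg => rw [contr_smul, hg, smul_zero]

omit [FiniteDimensional F V] in
/-- Contraction with the lowest weight functional maps vectors of weight `w` to multiples of the
monomial `x^{w - μ}`. -/
theorem IsLowestDual.exists_contr_eq_monomial [CharZero F] (hf : IsLowestDual μ f)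
    {w : Fin n → F} {ξ : ProjMod F n V} (hw : ∀ i : Fin n, ⁅xd F i i, ξ⁆ = w i • ξ)
    (h0 : contr f ξ ≠ 0) :
    ∃ (c : Fin n →₀ ℕ) (a : F), a ≠ 0 ∧ contr f ξ = MvPolynomial.monomial c a ∧
      ∀ i, w i = μ i + c i := by
  have key : ∀ m, MvPolynomial.coeff m (contr f ξ) ≠ 0 → ∀ i, w i = μ i + m i := by
    intro m hm i
    have h := contr_lie_xd f i i ξ
    rw [hw, hf.weight, map_smul, contr_smul] at h
    have h1 := congrArg (MvPolynomial.coeff m) h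
    rw [MvPolynomial.coeff_sub, coeff_act_xd_self, MvPolynomial.coeff_smul,
      MvPolynomial.coeff_smul, smul_eq_mul, smul_eq_mul, ← sub_mul] at h1
    rw [mul_right_cancel₀ hm h1]
    ring
  obtain ⟨c, hc⟩ := MvPolynomial.ne_zero_iff.1 h0
  refine ⟨c, _, hc, ?_, key c hc⟩
  ext m
  rw [MvPolynomial.coeff_monomial]
  split_ifs with h
  · rw [h]
  · by_contra hm
    refine h (Finsupp.ext fun i => ?_)
    have := (key c hc i).symm.trans (key m hm i)
    exact_mod_cast add_left_cancel this

/-- Maximal vectors of a given weight are unique up to a scalar. -/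
theorem IsLowestDual.exists_smul_eq [CharZero F] [LieModule.IsIrreducible F (Gl F n) V]
    (hf : IsLowestDual μ f) {w : Fin n → F} {ξ η : ProjMod F n V} (hξ : IsMaximalVector w ξ)
    (hη : IsMaximalVector w η) : ∃ c : F, η = c • ξ := by
  obtain ⟨c, a, ha, hc, hwc⟩ := hf.exists_contr_eq_monomial hξ.2.2
    fun h => hξ.1 (hf.eq_zero_of_contr hξ.2.1 h)
  obtain ⟨d, b, hb, hd, hwd⟩ := hf.exists_contr_eq_monomial hη.2.2
    fun h => hη.1 (hf.eq_zero_of_contr hη.2.1 h)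
  have hcd : c = d := by
    ext i
    have := (hwc i).symm.trans (hwd i)
    exact_mod_cast add_left_cancel this
  subst hcd
  refine ⟨b / a, sub_eq_zero.1 (hf.eq_zero_of_contr (fun i j hij => ?_) ?_)⟩
  · rw [lie_sub, lie_smul, hξ.2.1 i j hij, hη.2.1 i j hij, smul_zero, sub_zero]
  · rw [map_sub, map_smul, hc, hd, MvPolynomial.smul_monomial, smul_eq_mul,
      div_mul_cancel₀ b ha, sub_self]

end Maximal

section UpperBound

variable {F : Type*} [Field F] [CharZero F] {n : ℕ} {V : Type*} [AddCommGroup V] [Module F V]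
  [FiniteDimensional F V] [LieRingModule (Gl F n) V] [LieModule F (Gl F n) V]
  {μ : Fin n → F} {f : Module.Dual F V}

theorem isSl2Triple_matE {s t : Fin n} (h : s ≠ t) :
    IsSl2Triple (matE F t t - matE F s s) (matE F t s) (matE F s t) where
  h_ne_zero := by
    intro h0
    have := congrFun (congrFun h0 t) t
    simp [matE, h] at this
  lie_e_f := by simp [Ring.lie_def, matE]
  lie_h_e_nsmul := by
    simp [Ring.lie_def, matE, sub_mul, mul_sub, h, two_smul]
  lie_h_f_nsmul := by
    simp [Ring.lie_def, matE, sub_mul, mul_sub, h.symm, two_smul]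
    abel

/-- The representation theory of `sl₂`, applied to the dual of `V`: the weight `μ` is dominant, and
the raising operator `E_{s,t}` is nilpotent on the lowest weight functional of the order predicted
by `μ`. -/
theorem IsLowestDual.exists_nat (hf : IsLowestDual μ f) {s t : Fin n} (h : s < t) :
    ∃ m : ℕ, μ s - μ t = m ∧
      (LieModule.toEnd F (Gl F n) (Module.Dual F V) (matE F s t) ^ (m + 1)) f = 0 := by
  have P : IsSl2Triple.HasPrimitiveVectorWith (isSl2Triple_matE (F := F) h.ne) f (μ s - μ t) :=
    { ne_zero := hf.ne_zero
      lie_h := by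
        rw [sub_lie, hf.weight, hf.weight]
        exact (sub_smul (-μ t) (-μ s) f).symm.trans (congrArg (· • f) (by ring))
      lie_e := hf.lower t s h }
  obtain ⟨m, hm⟩ := P.exists_nat
  exact ⟨m, hm, P.pow_toEnd_f_eq_zero_of_eq_nat hm⟩

omit [CharZero F] [FiniteDimensional F V] in
theorem contr_toEnd_pow {s t : Fin n} {ξ : ProjMod F n V} (hξ : ⁅xd F s t, ξ⁆ = 0) (k : ℕ) :
    contr ((LieModule.toEnd F (Gl F n) (Module.Dual F V) (matE F s t) ^ k) f) ξ =
      (act (xd F s t) ^ k) (contr f ξ) := by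
  induction k with
  | zero => simp
  | succ k ih =>
    have h := contr_lie_xd ((LieModule.toEnd F (Gl F n) (Module.Dual F V) (matE F s t) ^ k) f) s t ξ
    rw [hξ, map_zero, eq_comm, sub_eq_zero] at h
    rw [pow_succ', Module.End.mul_apply, pow_succ', Module.End.mul_apply, ← ih, h]
    rfl

/-- The weight of a maximal vector of `𝒜 ⊗ V` is `μ + c` for some `c ∈ I(μ, |c|)`. -/
theorem IsLowestDual.exists_mem_idxSet [LieModule.IsIrreducible F (Gl F n) V]
    (hf : IsLowestDual μ f) {w : Fin n → F} {ξ : ProjMod F n V} (hξ : IsMaximalVector w ξ) :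
    ∃ c : Fin n → ℕ, c ∈ idxSet μ (∑ i, c i) ∧ w = fun i => μ i + (c i : F) := by
  obtain ⟨c, a, ha, hc, hwc⟩ := hf.exists_contr_eq_monomial hξ.2.2
    fun h => hξ.1 (hf.eq_zero_of_contr hξ.2.1 h)
  refine ⟨c, ⟨rfl, fun s t hst => ?_⟩, funext hwc⟩
  have hlt : s < t := by rw [Fin.lt_def]; omega
  obtain ⟨m, hm, hm0⟩ := hf.exists_nat hlt
  have hcm : c t ≤ m := by
    by_contra hlt'
    refine act_xd_pow_monomial_ne_zero hlt.ne (m + 1) c a ha (by omega) ?_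
    rw [← hc, ← contr_toEnd_pow (hξ.2.1 s t hlt), hm0]
    simpa using contr_smul (0 : F) 0 ξ
  exact ⟨m - c t, by rw [hm, Nat.add_sub_cancel' hcm]⟩

end UpperBound

/-! ### The grading of `𝒜 ⊗ V` and the operator `φ` -/

section Grading

variable {F : Type*} [Field F] {n : ℕ} {V : Type*} [AddCommGroup V] [Module F V]

/-- The projection of `𝒜 ⊗ V` onto its homogeneous component of degree `j`. -/
def degProj (j : ℕ) : Module.End F (ProjMod F n V) :=
  (TensorProduct.map (MvPolynomial.homogeneousComponent j) LinearMap.id :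
    Poly F n ⊗[F] V →ₗ[F] Poly F n ⊗[F] V)

theorem degProj_ten (j : ℕ) (f : Poly F n) (v : V) :
    degProj j (ten f v) = ten (MvPolynomial.homogeneousComponent j f) v := rfl

theorem homogeneousComponent_monomial (j : ℕ) (c : Fin n →₀ ℕ) (a : F) :
    MvPolynomial.homogeneousComponent j (MvPolynomial.monomial c a) =
      if c.degree = j then MvPolynomial.monomial c a else 0 :=
  (MvPolynomial.homogeneousComponent_of_mem
    (MvPolynomial.isHomogeneous_monomial a rfl)).trans (by simp only [eq_comm])

theorem degProj_ten_one (j : ℕ) (v : V) :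
    degProj j (ten (1 : Poly F n) v) = if j = 0 then ten 1 v else 0 := by
  rw [degProj_ten, ← MvPolynomial.C_1, MvPolynomial.C_apply, homogeneousComponent_monomial]
  simp only [map_zero, eq_comm (a := 0)]
  split_ifs
  exacts [rfl, zero_ten v]

theorem degProj_zero_mulX (k : Fin n) (m : ProjMod F n V) : degProj 0 (mulX k m) = 0 := by
  induction m using projMod_induction with
  | zero => simp
  | ten f v =>
    rw [mulX_ten, degProj_ten, MvPolynomial.homogeneousComponent_zero,
      ← MvPolynomial.constantCoeff_eq, map_mul, MvPolynomial.constantCoeff_X, zero_mul, map_zero,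
      zero_ten]
  | add a b ha hb => rw [map_add, map_add, ha, hb, add_zero]

theorem degProj_succ_mulX (j : ℕ) (k : Fin n) (m : ProjMod F n V) :
    degProj (j + 1) (mulX k m) = mulX k (degProj j m) := by
  induction m using projMod_induction with
  | zero => simp
  | ten f v =>
    rw [mulX_ten, degProj_ten, degProj_ten, mulX_ten]
    congr 1
    induction f using MvPolynomial.induction_on' with
    | add p q hp hq => rw [mul_add, map_add, map_add, hp, hq, mul_add]
    | monomial c a =>
      rw [MvPolynomial.X, MvPolynomial.monomial_mul, homogeneousComponent_monomial,
        homogeneousComponent_monomial, map_add, Finsupp.degree_single, add_comm 1]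
      simp only [Nat.succ_inj]
      split_ifs
      · rw [MvPolynomial.monomial_mul]
      · rw [mul_zero]
  | add a b ha hb => rw [map_add, map_add, map_add, map_add, ha, hb]

theorem ten_one_mem_degPart (v : V) : ten (1 : Poly F n) v ∈ degPart F n V 0 :=
  Submodule.subset_span ⟨0, v, by simp, rfl⟩

theorem mulX_mem_degPart {j : ℕ} {m : ProjMod F n V} (hm : m ∈ degPart F n V j) (k : Fin n) :
    mulX k m ∈ degPart F n V (j + 1) := by
  have : degPart F n V j ≤ (degPart F n V (j + 1)).comap (mulX k) := by
    refine Submodule.span_le.2 ?_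
    rintro _ ⟨c, v, hc, rfl⟩
    refine Submodule.subset_span ⟨Finsupp.single k 1 + c, v, ?_, ?_⟩
    · simp [Finset.sum_add_distrib, hc, Finsupp.single_apply, add_comm]
    · rw [mulX_ten, MvPolynomial.X, MvPolynomial.monomial_mul, one_mul]
  exact this hm

theorem degProj_mem (j : ℕ) (m : ProjMod F n V) : degProj j m ∈ degPart F n V j := by
  have : ⨅ j, (degPart F n V j).comap (degProj j) = ⊤ := by
    refine eq_top_of_mulX (fun v => ?_) fun k m hm => ?_ <;>
      simp only [Submodule.mem_iInf, Submodule.mem_comap] at *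
    · intro j
      rw [degProj_ten_one]
      split_ifs with h
      · rw [h]; exact ten_one_mem_degPart v
      · exact zero_mem _
    · rintro (_ | j)
      · rw [degProj_zero_mulX]; exact zero_mem _
      · rw [degProj_succ_mulX]; exact mulX_mem_degPart (hm j) k
  have hm : m ∈ ⨅ j, (degPart F n V j).comap (degProj j) := by rw [this]; trivial
  exact (Submodule.mem_iInf _).1 hm j

theorem degProj_of_mem {j : ℕ} {m : ProjMod F n V} (hm : m ∈ degPart F n V j) :
    degProj j m = m := by
  have : degPart F n V j ≤ LinearMap.eqLocus (degProj j) LinearMap.id := by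
    refine Submodule.span_le.2 ?_
    rintro _ ⟨c, v, hc, rfl⟩
    change degProj j (ten _ v) = _
    rw [degProj_ten, homogeneousComponent_monomial, Finsupp.degree_eq_sum, if_pos hc]
    rfl
  exact this hm

theorem exists_sum_degProj (m : ProjMod F n V) :
    ∃ N, ∀ N' ≥ N, ∑ j ∈ Finset.range N', degProj j m = m := by
  induction m using projMod_induction with
  | zero => exact ⟨0, by simp⟩
  | ten f v =>
    refine ⟨f.totalDegree + 1, fun N' hN => ?_⟩
    simp only [degProj_ten]
    rw [← sum_ten, Finset.eventually_constant_sum (N := f.totalDegree + 1) _ hN,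
      MvPolynomial.sum_homogeneousComponent]
    exact fun j hj => MvPolynomial.homogeneousComponent_eq_zero _ _ hj
  | add a b ha hb =>
    obtain ⟨A, hA⟩ := ha
    obtain ⟨B, hB⟩ := hb
    refine ⟨max A B, fun N' hN => ?_⟩
    simp only [map_add, Finset.sum_add_distrib]
    rw [hA N' (le_of_max_le_left hN), hB N' (le_of_max_le_right hN)]

theorem eq_zero_of_degProj {m : ProjMod F n V} (h : ∀ j, degProj j m = 0) : m = 0 := by
  obtain ⟨N, hN⟩ := exists_sum_degProj m
  rw [← hN N le_rfl]
  simp [h]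

theorem iSup_degPart : ⨆ j, degPart F n V j = ⊤ := by
  refine eq_top_of_mulX (fun v => ?_) fun k m hm => ?_
  · exact Submodule.mem_iSup_of_mem 0 (ten_one_mem_degPart v)
  · have : ⨆ j, degPart F n V j ≤ (⨆ j, degPart F n V j).comap (mulX k) :=
      iSup_le fun j m hm => Submodule.mem_iSup_of_mem (j + 1) (mulX_mem_degPart hm k)
    exact this hm

instance [FiniteDimensional F V] (j : ℕ) : FiniteDimensional F (degPart F n V j) := by
  let T : (Fin n →₀ ℕ) → V →ₗ[F] ProjMod F n V := fun c =>
    (TensorProduct.mk F (Poly F n) V (MvPolynomial.monomial c 1) : V →ₗ[F] Poly F n ⊗[F] V)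
  have : Finite {c : Fin n →₀ ℕ // c.degree ≤ j} := Finsupp.finite_of_degree_le j
  have hle : degPart F n V j ≤
      ⨆ c : {c : Fin n →₀ ℕ // c.degree ≤ j}, LinearMap.range (T c) := by
    refine Submodule.span_le.2 ?_
    rintro _ ⟨c, v, hc, rfl⟩
    exact Submodule.mem_iSup_of_mem ⟨c, by rw [Finsupp.degree_eq_sum, hc]⟩ ⟨v, rfl⟩
  exact Submodule.finiteDimensional_of_le hle

variable [LieRingModule (Gl F n) V] [LieModule F (Gl F n) V]

theorem degProj_lie_xd (j : ℕ) (a b : Fin n) (m : ProjMod F n V) :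
    degProj j ⁅xd F a b, m⁆ = ⁅xd F a b, degProj j m⁆ := by
  have : ⨅ j, LinearMap.eqLocus (degProj j ∘ₗ piOp (xd F a b))
      (piOp (xd F a b) ∘ₗ degProj j : Module.End F (ProjMod F n V)) = ⊤ := by
    refine eq_top_of_mulX (fun v => ?_) fun k m hm => ?_ <;>
      simp only [Submodule.mem_iInf, LinearMap.mem_eqLocus, LinearMap.comp_apply,
        ← lie_witt_def] at *
    · intro j
      rw [lie_xd_ten_one, degProj_ten_one, degProj_ten_one]
      split_ifs
      · rw [lie_xd_ten_one]
      · rw [lie_zero]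
    · rintro (_ | j)
      · rw [degProj_zero_mulX, lie_xd_mulX, map_add, degProj_zero_mulX, lie_zero, zero_add]
        split_ifs
        · exact degProj_zero_mulX _ _
        · exact map_zero _
      · rw [degProj_succ_mulX, lie_xd_mulX, map_add, degProj_succ_mulX, hm, lie_xd_mulX]
        split_ifs
        · rw [degProj_succ_mulX]
        · rw [map_zero]
  have hm : m ∈ ⨅ j, LinearMap.eqLocus (degProj j ∘ₗ piOp (xd F a b))
      (piOp (xd F a b) ∘ₗ degProj j : Module.End F (ProjMod F n V)) := by rw [this]; trivial
  exact (Submodule.mem_iInf _).1 hm j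

end Grading

section Phi

/-- The product of powers of commuting elements, one exponent being increased by one. -/
theorem prod_ofFn_pow_succ {A : Type*} [Monoid A] {n : ℕ} (a : Fin n → A)
    (h : ∀ i j, Commute (a i) (a j)) (l : Fin n → ℕ) (k : Fin n) :
    (List.ofFn fun i => a i ^ ((if k = i then 1 else 0) + l i)).prod =
      a k * (List.ofFn fun i => a i ^ l i).prod := by
  induction n with
  | zero => exact k.elim0
  | succ n ih =>
    rw [List.ofFn_succ, List.ofFn_succ, List.prod_cons, List.prod_cons]
    refine Fin.cases ?_ (fun k => ?_) k
    · simp [(Fin.succ_ne_zero _).symm, pow_add, mul_assoc]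
    · have := ih (fun i => a i.succ) (fun i j => h _ _) (fun i => l i.succ) k
      simp only [Fin.succ_inj, Fin.succ_ne_zero, if_false, zero_add]
      rw [this, ← mul_assoc, ← mul_assoc, ((h k.succ 0).pow_right (l 0)).eq]

variable {F : Type*} [Field F] {n : ℕ} {V : Type*} [AddCommGroup V] [Module F V]
  [LieRingModule (Gl F n) V] [LieModule F (Gl F n) V]

theorem lie_pT_comm (i j : Fin n) (m : ProjMod F n V) :
    ⁅pT F i, ⁅pT F j, m⁆⁆ = ⁅pT F j, ⁅pT F i, m⁆⁆ := by
  rw [leibniz_lie, lie_pT_pT, zero_lie, zero_add]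

theorem phi_ten_one (v : V) : phi F n V (ten 1 v) = ten 1 v := by
  have := phi_monomial (F := F) (n := n) 0 v
  simpa [pPow] using this

/-- `φ` intertwines the multiplication by `x_k` with the action of `p_k`. -/
theorem phi_mulX (k : Fin n) (m : ProjMod F n V) :
    phi F n V (mulX k m) = ⁅pT F k, phi F n V m⁆ := by
  induction m using projMod_induction with
  | zero => simp
  | add a b ha hb => rw [map_add, map_add, map_add, lie_add, ha, hb]
  | ten f v =>
    induction f using MvPolynomial.induction_on' with
    | add p q hp hq => rw [add_ten, map_add, map_add, map_add, lie_add, hp, hq]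
    | monomial c a =>
      have h1 : MvPolynomial.monomial c a = a • (MvPolynomial.monomial c 1 : Poly F n) := by
        rw [MvPolynomial.smul_monomial, smul_eq_mul, mul_one]
      rw [h1, smul_ten, map_smul, map_smul, map_smul, lie_smul, mulX_ten, MvPolynomial.X,
        MvPolynomial.monomial_mul, one_mul, phi_monomial, phi_monomial, pPow, pPow]
      congr 1
      have := prod_ofFn_pow_succ
        (fun i => LieModule.toEnd F (Witt F n) (ProjMod F n V) (pT F i))
        (fun i j => LinearMap.ext (lie_pT_comm i j)) c k
      simp only [Finsupp.add_apply, Finsupp.single_apply]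
      rw [this]
      rfl

/-- `φ` is a homomorphism of `gl(n)`-modules. -/
theorem phi_lie_xd (a b : Fin n) (m : ProjMod F n V) :
    phi F n V ⁅xd F a b, m⁆ = ⁅xd F a b, phi F n V m⁆ := by
  have : LinearMap.eqLocus (phi F n V ∘ₗ piOp (xd F a b)) (piOp (xd F a b) ∘ₗ phi F n V) = ⊤ := by
    refine eq_top_of_mulX (fun v => ?_) fun k m hm => ?_ <;>
      simp only [LinearMap.mem_eqLocus, LinearMap.comp_apply, ← lie_witt_def] at *
    · rw [lie_xd_ten_one, phi_ten_one, phi_ten_one, lie_xd_ten_one]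
    · rw [lie_xd_mulX, phi_mulX, map_add, phi_mulX, hm, leibniz_lie (xd F a b), lie_xd_pT, add_comm]
      split_ifs
      · rw [phi_mulX]
      · rw [map_zero, zero_lie]
  have hm : m ∈ LinearMap.eqLocus (phi F n V ∘ₗ piOp (xd F a b))
    (piOp (xd F a b) ∘ₗ phi F n V) := by rw [this]; trivial
  exact hm

theorem degProj_phi {c : F} (hc : ∀ v : V, ∑ i : Fin n, ⁅matE F i i, v⁆ = c • v) (j : ℕ)
    (m : ProjMod F n V) : degProj j (phi F n V m) = phi F n V (degProj j m) := by
  have : ⨅ j, LinearMap.eqLocus (degProj j ∘ₗ phi F n V) (phi F n V ∘ₗ degProj j) = ⊤ := by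
    refine eq_top_of_mulX (fun v => ?_) fun k m hm => ?_ <;>
      simp only [Submodule.mem_iInf, LinearMap.mem_eqLocus, LinearMap.comp_apply] at *
    · intro j
      rw [phi_ten_one, degProj_ten_one]
      split_ifs
      · rw [phi_ten_one]
      · rw [map_zero]
    · rintro (_ | j)
      · rw [degProj_zero_mulX, phi_mulX, lie_pT c hc, map_add, map_sum, map_smul]
        simp [degProj_zero_mulX]
      · rw [degProj_succ_mulX, phi_mulX, phi_mulX, lie_pT c hc, lie_pT c hc, map_add, map_sum,
          map_smul]
        simp only [degProj_succ_mulX, degProj_lie_xd, hm]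
  have hm : m ∈ ⨅ j, LinearMap.eqLocus (degProj j ∘ₗ phi F n V) (phi F n V ∘ₗ degProj j) := by
    rw [this]; trivial
  exact (Submodule.mem_iInf _).1 hm j

/-- As `φ` preserves the finite-dimensional homogeneous components, it is injective if and only
if it is surjective. -/
theorem phi_injective_iff_surjective [FiniteDimensional F V] {c : F}
    (hc : ∀ v : V, ∑ i : Fin n, ⁅matE F i i, v⁆ = c • v) :
    Function.Injective (phi F n V) ↔ Function.Surjective (phi F n V) := by
  have hmem : ∀ j, ∀ m ∈ degPart F n V j, phi F n V m ∈ degPart F n V j := by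
    intro j m hm
    rw [← degProj_of_mem hm, ← degProj_phi hc]
    exact degProj_mem _ _
  constructor
  · intro h
    rw [← LinearMap.range_eq_top, eq_top_iff, ← iSup_degPart]
    refine iSup_le fun j m hm => ?_
    have hinj : Function.Injective ((phi F n V).restrict (hmem j)) := fun x y hxy =>
      Subtype.ext (h (congrArg Subtype.val hxy))
    obtain ⟨x, hx⟩ := LinearMap.injective_iff_surjective.1 hinj ⟨m, hm⟩
    exact ⟨x, congrArg Subtype.val hx⟩
  · intro h
    have hker : ∀ j, ∀ m ∈ degPart F n V j, phi F n V m = 0 → m = 0 := by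
      intro j m hm h0
      have hsurj : Function.Surjective ((phi F n V).restrict (hmem j)) := by
        rintro ⟨y, hy⟩
        obtain ⟨x, hx⟩ := h y
        refine ⟨⟨degProj j x, degProj_mem j x⟩, Subtype.ext ?_⟩
        change phi F n V (degProj j x) = y
        rw [← degProj_phi hc, hx, degProj_of_mem hy]
      have := LinearMap.injective_iff_surjective.2 hsurj
        (a₁ := ⟨m, hm⟩) (a₂ := 0) (Subtype.ext (by simpa using h0))
      exact congrArg Subtype.val this
    rw [injective_iff_map_eq_zero]
    intro m hm
    have hj : ∀ j, degProj j m = 0 := fun j =>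
      hker j _ (degProj_mem j m) (by rw [← degProj_phi hc, hm, map_zero])
    exact eq_zero_of_degProj hj

end Phi

/-! ### The Casimir operator -/

section Casimir

open Polynomial in
theorem commute_aeval {R A : Type*} [CommSemiring R] [Semiring A] [Algebra R A] {S T : A}
    (h : Commute S T) (p : R[X]) : Commute S (aeval T p) := by
  induction p using Polynomial.induction_on' with
  | add p q hp hq => rw [map_add]; exact hp.add_right hq
  | monomial k a =>
    rw [aeval_monomial]
    exact Commute.mul_right (Algebra.commutes a S).symm (h.pow_right k)

variable {F : Type*} [Field F] {n : ℕ} {V : Type*} [AddCommGroup V] [Module F V]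
  [LieRingModule (Gl F n) V] [LieModule F (Gl F n) V]

/-- The Casimir operator `∑ E_{l,i} E_{i,l}` of `gl(n)` on `𝒜 ⊗ V`, where `E_{i,l}` acts as
`x_i ∂_{x_l}`. -/
def casimir : Module.End F (ProjMod F n V) :=
  ∑ i, ∑ l, LieModule.toEnd F (Witt F n) (ProjMod F n V) (xd F l i) *
    LieModule.toEnd F (Witt F n) (ProjMod F n V) (xd F i l)

theorem casimir_apply (m : ProjMod F n V) :
    casimir m = ∑ i : Fin n, ∑ l : Fin n, ⁅xd F l i, ⁅xd F i l, m⁆⁆ := by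
  simp [casimir, LinearMap.sum_apply]

theorem casimir_lie_xd (a b : Fin n) (m : ProjMod F n V) :
    casimir ⁅xd F a b, m⁆ = ⁅xd F a b, casimir m⁆ := by
  simp only [casimir_apply, lie_sum]
  have h : ∀ i l, ⁅xd F a b, ⁅xd F l i, ⁅xd F i l, m⁆⁆⁆ =
      ⁅xd F l i, ⁅xd F i l, ⁅xd F a b, m⁆⁆⁆ +
      (((if b = l then ⁅xd F a i, ⁅xd F i l, m⁆⁆ else 0) -
        (if i = a then ⁅xd F l b, ⁅xd F i l, m⁆⁆ else 0)) +
      ((if b = i then ⁅xd F l i, ⁅xd F a l, m⁆⁆ else 0) -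
        (if l = a then ⁅xd F l i, ⁅xd F i b, m⁆⁆ else 0))) := by
    intro i l
    rw [leibniz_lie (xd F a b), leibniz_lie (xd F a b) (xd F i l), lie_xd_xd, lie_xd_xd, lie_add,
      sub_lie, sub_lie, lie_sub]
    split_ifs <;> (try simp only [zero_lie, lie_zero]) <;> abel
  simp only [h, Finset.sum_add_distrib, Finset.sum_sub_distrib]
  rw [Finset.sum_comm (f := fun i l => if i = a then ⁅xd F l b, ⁅xd F i l, m⁆⁆ else 0),
    Finset.sum_comm (f := fun i l => if b = i then ⁅xd F l i, ⁅xd F a l, m⁆⁆ else 0)]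
  simp

theorem casimir_mulX (k : Fin n) (m : ProjMod F n V) :
    casimir (mulX k m) = mulX k (casimir m) + (2 : F) • ∑ l, mulX l ⁅xd F k l, m⁆ +
      (n : F) • mulX k m := by
  have h : ∀ i l, ⁅xd F l i, ⁅xd F i l, mulX k m⁆⁆ = mulX k ⁅xd F l i, ⁅xd F i l, m⁆⁆ +
      (if i = k then mulX l ⁅xd F i l, m⁆ else 0) +
      (if l = k then mulX i ⁅xd F l i, m⁆ else 0) + (if l = k then mulX l m else 0) := by
    intro i l
    rw [lie_xd_mulX, lie_add, lie_xd_mulX]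
    split_ifs <;> simp [lie_xd_mulX, add_assoc]
  rw [casimir_apply, casimir_apply]
  simp only [h, Finset.sum_add_distrib, map_sum]
  rw [Finset.sum_comm (f := fun i l => if i = k then mulX l ⁅xd F i l, m⁆ else 0)]
  simp [two_smul, add_assoc, Nat.cast_smul_eq_nsmul]

theorem exists_casimir_eq {w : Fin n → F} {ξ : ProjMod F n V} (hξ : IsMaximalVector w ξ) :
    ∃ κ : F, casimir ξ = κ • ξ := by
  have h : ∀ i l : Fin n, ∃ c : F, ⁅xd F l i, ⁅xd F i l, ξ⁆⁆ = c • ξ := by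
    intro i l
    rcases lt_trichotomy i l with h | rfl | h
    · exact ⟨0, by rw [hξ.2.1 i l h, lie_zero, zero_smul]⟩
    · exact ⟨w i * w i, by rw [hξ.2.2, lie_smul, hξ.2.2, smul_smul]⟩
    · refine ⟨w l - w i, ?_⟩
      rw [leibniz_lie, hξ.2.1 l i h, lie_zero, add_zero, lie_xd_xd, if_pos rfl, if_pos rfl,
        sub_lie, hξ.2.2, hξ.2.2, sub_smul]
  choose c hc using h
  refine ⟨∑ i, ∑ l, c i l, ?_⟩
  rw [casimir_apply]
  simp only [hc, Finset.sum_smul]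

theorem casimir_phi (m : ProjMod F n V) : phi F n V (casimir m) = casimir (phi F n V m) := by
  simp only [casimir_apply, map_sum, phi_lie_xd]

open Polynomial in
theorem aeval_casimir_lie_xd (p : F[X]) (a b : Fin n) (m : ProjMod F n V) :
    aeval casimir p ⁅xd F a b, m⁆ = ⁅xd F a b, aeval casimir p m⁆ := by
  have h : Commute (LieModule.toEnd F (Witt F n) (ProjMod F n V) (xd F a b)) casimir :=
    LinearMap.ext fun m => (casimir_lie_xd a b m).symm
  exact (LinearMap.congr_fun (commute_aeval h p) m).symm

open Polynomial in
theorem aeval_casimir_phi (p : F[X]) (m : ProjMod F n V) :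
    phi F n V (aeval casimir p m) = aeval casimir p (phi F n V m) :=
  LinearMap.congr_fun (commute_aeval (S := phi F n V) (LinearMap.ext casimir_phi) p) m

open Polynomial in
theorem aeval_casimir_mem_degPart (p : F[X]) {j : ℕ} {m : ProjMod F n V}
    (hm : m ∈ degPart F n V j) : aeval casimir p m ∈ degPart F n V j := by
  have h : Commute (degProj j : Module.End F (ProjMod F n V)) casimir := LinearMap.ext fun m => by
    simp only [Module.End.mul_apply, casimir_apply, map_sum, degProj_lie_xd]
  have h' := LinearMap.congr_fun (commute_aeval h p) m
  rw [Module.End.mul_apply, Module.End.mul_apply, degProj_of_mem hm] at h'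
  rw [← h']
  exact degProj_mem j _

open Polynomial in
/-- For a maximal vector `ξ` the Casimir operator is triangular on the vectors `x_t ξ` modulo
lowering operators. -/
theorem casimir_mulX_maximal {w : Fin n → F} {ξ : ProjMod F n V} (hξ : IsMaximalVector w ξ) {κ : F}
    (hκ : casimir ξ = κ • ξ) (t : Fin n) :
    aeval casimir (X - C (κ + n + 2 * (w t - (t : ℕ)))) (mulX t ξ) =
      (2 : F) • ∑ l ∈ Finset.Iio t, ⁅xd F t l, mulX l ξ⁆ := by
  have h : ∀ l, mulX l ⁅xd F t l, ξ⁆ = (if l = t then w t • mulX t ξ else 0) +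
      if l < t then ⁅xd F t l, mulX l ξ⁆ - mulX t ξ else 0 := by
    intro l
    rcases lt_trichotomy l t with h | rfl | h
    · rw [if_neg h.ne, if_pos h, lie_xd_mulX, if_pos rfl]; abel
    · simp [hξ.2.2]
    · rw [if_neg h.ne', if_neg h.not_gt, hξ.2.1 t l h, map_zero, add_zero]
  have hs : ∑ l, mulX l ⁅xd F t l, ξ⁆ = (w t - (t : ℕ)) • mulX t ξ +
      ∑ l ∈ Finset.Iio t, ⁅xd F t l, mulX l ξ⁆ := by
    simp only [h, Finset.sum_add_distrib]
    rw [← Finset.sum_filter]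
    have : Finset.univ.filter (fun l => l < t) = Finset.Iio t := by ext; simp
    rw [← Finset.sum_filter, this, Finset.sum_sub_distrib, Finset.sum_const (s := Finset.Iio t),
      Fin.card_Iio, sub_smul, Nat.cast_smul_eq_nsmul]
    simp only [Finset.filter_eq', Finset.mem_univ, if_true, Finset.sum_singleton]
    abel
  rw [map_sub, aeval_X, aeval_C, LinearMap.sub_apply, casimir_mulX, hκ, hs,
    Module.algebraMap_end_apply, map_smul]
  module

end Casimir

/-! ### A triangular recursion -/

section Recursion

open Polynomial

variable {F : Type*} [Field F] {n : ℕ}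

/-- If `A_t((X - γ_t) p)` is a combination of images of the `A_l(p)` with `l < t`, then `A_t`
annihilates the multiples of `∏_{l ≤ t} (X - γ_l)`. -/
theorem triangular_vanish {M : Type*} [AddCommGroup M] [Module F M] (A : Fin n → F[X] →ₗ[F] M)
    (γ : Fin n → F) (T : Fin n → Fin n → M →ₗ[F] M)
    (h : ∀ t p, A t ((X - C (γ t)) * p) = ∑ l ∈ Finset.Iio t, T t l (A l p)) (t : Fin n)
    (S : Finset (Fin n)) (hS : Finset.Iic t ⊆ S) : A t (∏ l ∈ S, (X - C (γ l))) = 0 := by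
  induction t using WellFoundedLT.induction generalizing S with
  | ind t ih =>
    rw [← Finset.mul_prod_erase S _ (hS (Finset.mem_Iic.2 le_rfl)), h]
    refine Finset.sum_eq_zero fun l hl => ?_
    rw [Finset.mem_Iio] at hl
    rw [ih l hl, map_zero]
    intro i hi
    rw [Finset.mem_Iic] at hi
    exact Finset.mem_erase.2 ⟨(hi.trans_lt hl).ne, hS (Finset.mem_Iic.2 (hi.trans hl.le))⟩

/-- Suppose that linear functionals `α_t` on `F[X]` satisfy
`α_t((X - γ_t) p) = ∑_{l < t} g_l α_l(p)` and `α_t(1) = a`. Then the values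
`α_s(∏_{t < s} (X - γ_t))` factor. -/
theorem triangular_recursion (α : Fin n → F[X] →ₗ[F] F) (γ g : Fin n → F) (a : F)
    (h1 : ∀ t, α t 1 = a)
    (h : ∀ t p, α t ((X - C (γ t)) * p) = ∑ l ∈ Finset.Iio t, g l * α l p) (s : Fin n) :
    α s (∏ l ∈ Finset.Iio s, (X - C (γ l))) = a * ∏ l ∈ Finset.Iio s, (γ s - γ l + g l) := by
  have hC : ∀ t (b : F), α t (C b) = b * a := by
    intro t b
    have : (C b : F[X]) = b • 1 := by rw [smul_eq_C_mul, mul_one]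
    rw [this, map_smul, h1, smul_eq_mul]
  -- `U` is the divided difference at `z` of the product of the first `k` factors.
  have key : ∀ (z : F) (k : ℕ), k ≤ n → ∃ U : F[X],
      (X - C z) * U = (∏ l with l.val < k, (X - C (γ l))) - C (∏ l with l.val < k, (z - γ l)) ∧
      ∑ l with l.val < k, g l * α l U =
        a * ((∏ l with l.val < k, (z - γ l + g l)) - ∏ l with l.val < k, (z - γ l)) := by
    intro z k
    induction k with
    | zero => exact fun _ => ⟨0, by simp, by simp⟩
    | succ k ih =>
      intro hk
      obtain ⟨U, hU1, hU2⟩ := ih (by omega)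
      let t : Fin n := ⟨k, hk⟩
      have hins : (Finset.univ.filter fun l : Fin n => l.val < k + 1) =
          insert t (Finset.univ.filter fun l : Fin n => l.val < k) := by
        ext l
        simp only [Finset.mem_filter, Finset.mem_univ, true_and, Finset.mem_insert, Fin.ext_iff, t]
        omega
      have hnot : t ∉ Finset.univ.filter fun l : Fin n => l.val < k := by simp [t]
      have hIio : Finset.Iio t = Finset.univ.filter fun l : Fin n => l.val < k := by
        ext l; simp [t, ← Fin.val_fin_lt]
      simp only [hins, Finset.prod_insert hnot, Finset.sum_insert hnot]
      set P := ∏ l with l.val < k, (X - C (γ l)) with hP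
      set Pz := ∏ l with l.val < k, (z - γ l) with hPz
      set Qz := ∏ l with l.val < k, (z - γ l + g l) with hQz
      refine ⟨(X - C (γ t)) * U + C Pz, ?_, ?_⟩
      · have : (X - C z) * ((X - C (γ t)) * U + C Pz) =
            (X - C (γ t)) * ((X - C z) * U) + (X - C z) * C Pz := by ring
        rw [this, hU1]
        simp only [map_mul, map_sub]
        ring
      · have e1 : (X - C (γ t)) * U = P - C Pz + (z - γ t) • U := by
          rw [← hU1, smul_eq_C_mul, map_sub]; ring
        have e2 : ∑ l with l.val < k, g l * α l ((X - C (γ t)) * U + C Pz) =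
            (∑ l with l.val < k, g l * α l P) + (z - γ t) * (a * (Qz - Pz)) := by
          rw [← hU2, e1, Finset.mul_sum, ← Finset.sum_add_distrib]
          refine Finset.sum_congr rfl fun l _ => ?_
          rw [map_add, map_add, map_sub, map_smul, smul_eq_mul]
          ring
        have e3 : ∑ l with l.val < k, g l * α l P = 0 := by
          refine Finset.sum_eq_zero fun l hl => ?_
          rw [hP, triangular_vanish α γ (fun _ l => g l • LinearMap.id) (by simpa using h) l,
            mul_zero]
          intro i hi
          simp only [Finset.mem_Iic, Finset.mem_filter, Finset.mem_univ, true_and,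
            Fin.le_def] at hi hl ⊢
          omega
        rw [e2, e3, map_add, h, hIio, hU2, hC]
        ring
  obtain ⟨U, hU1, hU2⟩ := key (γ s) s s.2.le
  have hIio : Finset.Iio s = Finset.univ.filter fun l : Fin n => l.val < s.val := by
    ext l; simp
  rw [hIio, ← sub_add_cancel (∏ l with l.val < s.val, (X - C (γ l)))
    (C (∏ l with l.val < s.val, (γ s - γ l))), ← hU1, map_add, h, hIio, hU2, hC]
  ring

end Recursion

/-! ### Construction of the maximal vectors -/

section Construction

open Polynomial

variable {F : Type*} [Field F] [CharZero F] {n : ℕ} {V : Type*} [AddCommGroup V] [Module F V]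
  [FiniteDimensional F V] [LieRingModule (Gl F n) V] [LieModule F (Gl F n) V]
  [LieModule.IsIrreducible F (Gl F n) V] {μ : Fin n → F} {f : Module.Dual F V}

/-- From a maximal vector `ξ` of weight `μ + c` one obtains a maximal vector of weight
`μ + c + e_s` by applying to `x_s ξ` a polynomial in the Casimir operator that removes the
contributions of `x_t ξ`, `t < s`. -/
theorem IsLowestDual.exists_isMaximalVector_succ (hf : IsLowestDual μ f)
    (hc : ∀ v : V, ∑ i : Fin n, ⁅matE F i i, v⁆ = (∑ k, μ k) • v) {c : Fin n → ℕ} {j : ℕ}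
    {ξ : ProjMod F n V} (hξj : ξ ∈ degPart F n V j)
    (hξ : IsMaximalVector (fun i => μ i + (c i : F)) ξ) {q : F} (hq : phi F n V ξ = q • ξ)
    (s : Fin n) (hs : ∀ t < s, ∃ d : ℕ, μ t - μ s = ((c s + 1 + d : ℕ) : F)) :
    ∃ η ∈ degPart F n V (j + 1),
      IsMaximalVector (fun i => μ i + ((c i + if i = s then 1 else 0 : ℕ) : F)) η ∧
      phi F n V η = (q * (μ s + c s - (s : ℕ) + ∑ k, μ k)) • η := by
  obtain ⟨κ, hκ⟩ := exists_casimir_eq hξ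
  let γ : Fin n → F := fun t => κ + n + 2 * (μ t + c t - (t : ℕ))
  let A : Fin n → F[X] →ₗ[F] ProjMod F n V := fun t =>
    LinearMap.applyₗ (mulX t ξ) ∘ₗ (aeval casimir).toLinearMap
  have hA : ∀ t p, A t p = aeval casimir p (mulX t ξ) := fun _ _ => rfl
  let T : Fin n → Fin n → Module.End F (ProjMod F n V) := fun t l =>
    (2 : F) • LieModule.toEnd F (Witt F n) (ProjMod F n V) (xd F t l)
  have hT : ∀ t l m, T t l m = (2 : F) • ⁅xd F t l, m⁆ := fun _ _ _ => rfl
  have hrec : ∀ t p, A t ((X - C (γ t)) * p) = ∑ l ∈ Finset.Iio t, T t l (A l p) := by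
    intro t p
    rw [hA, mul_comm, map_mul, Module.End.mul_apply, casimir_mulX_maximal hξ hκ t, map_smul,
      map_sum, Finset.smul_sum]
    refine Finset.sum_congr rfl fun l _ => ?_
    rw [aeval_casimir_lie_xd, hT, hA]
  set P : F[X] := ∏ l ∈ Finset.Iio s, (X - C (γ l)) with hP
  -- `x_s ξ` satisfies the polynomial `(X - γ_s) P`.
  have hkill : aeval casimir P (aeval casimir (X - C (γ s)) (mulX s ξ)) = 0 := by
    have := triangular_vanish A γ T hrec s (Finset.Iic s) le_rfl
    rw [← Finset.Iio_insert, Finset.prod_insert (by simp), mul_comm, hA, map_mul] at this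
    exact this
  have hlow : ∀ i < s, A i P = 0 := fun i hi =>
    triangular_vanish A γ T hrec i _ fun l hl =>
      Finset.mem_Iio.2 ((Finset.mem_Iic.1 hl).trans_lt hi)
  refine ⟨A s P, aeval_casimir_mem_degPart P (mulX_mem_degPart hξj s), ⟨?_, ?_, ?_⟩, ?_⟩
  · obtain ⟨c', a, ha, hmon, hcc⟩ := hf.exists_contr_eq_monomial hξ.2.2
      fun h => hξ.1 (hf.eq_zero_of_contr hξ.2.1 h)
    have hcc' : ∀ i, c' i = c i := fun i => by
      have := hcc i
      exact_mod_cast (add_left_cancel this).symm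
    let α : Fin n → F[X] →ₗ[F] F := fun t =>
      MvPolynomial.lcoeff F (Finsupp.single t 1 + c') ∘ₗ contr f ∘ₗ A t
    have hα : ∀ t p, α t p = MvPolynomial.coeff (Finsupp.single t 1 + c') (contr f (A t p)) :=
      fun _ _ => rfl
    have h1 : ∀ t, α t 1 = a := by
      intro t
      rw [hα, hA, map_one, Module.End.one_apply, contr_mulX, MvPolynomial.coeff_X_mul, hmon,
        MvPolynomial.coeff_monomial, if_pos rfl]
    have h2 : ∀ t p, α t ((X - C (γ t)) * p) =
        ∑ l ∈ Finset.Iio t, (2 * ((c l : F) + 1)) * α l p := by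
      intro t p
      rw [hα, hrec, map_sum, MvPolynomial.coeff_sum]
      refine Finset.sum_congr rfl fun l hl => ?_
      have h0 : contr ⁅matE F t l, f⁆ (A l p) = 0 := by
        rw [hf.lower t l (Finset.mem_Iio.1 hl)]
        simpa using contr_smul (0 : F) 0 (A l p)
      rw [hT, map_smul, contr_lie_xd, h0, sub_zero, MvPolynomial.coeff_smul, coeff_act_xd, hα,
        smul_eq_mul, hcc', add_comm c', mul_assoc]
    have h3 := triangular_recursion α γ _ a h1 h2 s
    intro h0
    rw [hα, ← hP, h0, map_zero, MvPolynomial.coeff_zero, eq_comm, mul_eq_zero,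
      or_iff_right ha, Finset.prod_eq_zero_iff] at h3
    obtain ⟨t, ht, h4⟩ := h3
    rw [Finset.mem_Iio] at ht
    obtain ⟨d, hd⟩ := hs t ht
    -- The factor with index `t` is `2 (μ_s - μ_t + c_s + 1 - (s - t))`, and `μ_t - μ_s > c_s`.
    have h5 : γ s - γ t + 2 * ((c t : F) + 1) = -((2 * (d + (s - t : ℕ)) : ℕ) : F) := by
      have h6 : ((s - t : ℕ) : F) = (s : ℕ) - (t : ℕ) := Nat.cast_sub (by omega)
      have h7 : μ t = μ s + ((c s + 1 + d : ℕ) : F) := by rw [← hd]; ring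
      simp only [γ]
      push_cast [h6, h7]
      ring
    rw [h5, neg_eq_zero, Nat.cast_eq_zero] at h4
    omega
  · intro i k hik
    rw [hA, ← aeval_casimir_lie_xd, lie_xd_mulX, hξ.2.1 i k hik, map_zero, zero_add]
    split_ifs with h
    · subst h
      exact hlow i hik
    · exact map_zero _
  · intro i
    rw [hA, ← aeval_casimir_lie_xd, lie_xd_mulX, hξ.2.2, ← map_smul]
    congr 1
    split_ifs with h
    · subst h
      rw [map_smul]
      simp only [if_true]
      push_cast
      module
    · simp [h]
  · have hp : (2 : F) • ⁅pT F s, ξ⁆ = aeval casimir (X - C (γ s)) (mulX s ξ) +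
        (2 * (μ s + c s - (s : ℕ) + ∑ k, μ k)) • mulX s ξ := by
      rw [lie_pT _ hc, map_sub, aeval_X, aeval_C, LinearMap.sub_apply, casimir_mulX, hκ,
        Module.algebraMap_end_apply, map_smul]
      simp only [γ]
      module
    have h2 : (2 : F) • phi F n V (A s P) =
        (2 : F) • (q * (μ s + c s - (s : ℕ) + ∑ k, μ k)) • A s P := by
      rw [hA, aeval_casimir_phi, phi_mulX, hq, lie_smul, map_smul, smul_comm, ← map_smul, hp,
        map_add, hkill, zero_add, map_smul]
      module
    exact smul_right_injective _ (two_ne_zero' F) h2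

omit [CharZero F] in
theorem exists_sub_eq_of_mem_idxSet {c : Fin n → ℕ} {j : ℕ} (h : c ∈ idxSet μ j) {t s : Fin n}
    (hts : t < s) : ∃ d : ℕ, μ t - μ s = ((c s + d : ℕ) : F) := by
  obtain ⟨k, hk⟩ : ∃ k, (s : ℕ) = t + 1 + k := ⟨s - t - 1, by omega⟩
  induction k generalizing s with
  | zero => exact h.2 t s hk
  | succ k ih =>
    let r : Fin n := ⟨t + 1 + k, by omega⟩
    obtain ⟨d, hd⟩ := ih (s := r) (by simp only [Fin.lt_def, r]; omega) rfl
    obtain ⟨e, he⟩ := h.2 r s (by simp only [r]; omega)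
    refine ⟨c r + d + e, ?_⟩
    rw [← sub_add_sub_cancel _ (μ r), hd, he]
    push_cast
    ring

omit [CharZero F] in
theorem qScalar_succ (c : Fin n → ℕ) (s : Fin n) :
    qScalar μ (fun i => c i + if i = s then 1 else 0) =
      qScalar μ c * (μ s + c s - (s : ℕ) + ∑ k, μ k) := by
  have h : ∀ i : Fin n, (∏ k ∈ Finset.Icc 1 (c i + if i = s then 1 else 0),
      (μ i + ∑ k, μ k - ((i : ℕ) + 1 : F) + (k : F))) =
      (∏ k ∈ Finset.Icc 1 (c i), (μ i + ∑ k, μ k - ((i : ℕ) + 1 : F) + (k : F))) *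
        if i = s then μ s + c s - (s : ℕ) + ∑ k, μ k else 1 := by
    intro i
    split_ifs with h
    · subst h
      rw [Finset.prod_Icc_succ_top (by omega)]
      congr 1
      push_cast
      ring
    · rw [add_zero, mul_one]
  simp only [qScalar, h, Finset.prod_mul_distrib]
  simp

/-- Every `c ∈ I(μ, j)` is the shift of the weight of a maximal vector on which `φ` acts by
`q_c`. -/
theorem exists_isMaximalVector (hμ : HasHighestWeight V μ) (hf : IsLowestDual μ f)
    (hc : ∀ v : V, ∑ i : Fin n, ⁅matE F i i, v⁆ = (∑ k, μ k) • v) (j : ℕ) (c : Fin n → ℕ)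
    (h : c ∈ idxSet μ j) :
    ∃ ξ ∈ degPart F n V j, IsMaximalVector (fun i => μ i + (c i : F)) ξ ∧
      phi F n V ξ = qScalar μ c • ξ := by
  induction j generalizing c with
  | zero =>
    obtain ⟨v, hv0, hv1, hv2⟩ := hμ
    have hc0 : c = 0 := funext fun i => (Finset.sum_eq_zero_iff.1 h.1) i (Finset.mem_univ i)
    subst hc0
    refine ⟨ten 1 v, ten_one_mem_degPart v, ⟨ten_one_ne_zero hv0, fun i k hik => ?_, fun i => ?_⟩,
      ?_⟩
    · rw [lie_xd_ten_one, hv1 i k hik, ten_zero]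
    · rw [lie_xd_ten_one, hv2, ten_smul]
      simp
    · rw [phi_ten_one]
      simp [qScalar]
  | succ j ih =>
    obtain ⟨s, hs⟩ : ∃ s, c s ≠ 0 := by
      by_contra! h0
      have := h.1
      simp [h0] at this
    obtain ⟨b, rfl⟩ : ∃ b : Fin n → ℕ, c = fun i => b i + if i = s then 1 else 0 := by
      refine ⟨fun i => c i - if i = s then 1 else 0, funext fun i => ?_⟩
      by_cases hi : i = s
      · subst hi; simp only [if_true]; omega
      · simp [hi]
    have hb : b ∈ idxSet μ j := by
      refine ⟨?_, fun r t hrt => ?_⟩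
      · have := h.1
        simpa [Finset.sum_add_distrib] using this
      · obtain ⟨d, hd⟩ := h.2 r t hrt
        exact ⟨(if t = s then 1 else 0) + d, by rw [hd, add_assoc]⟩
    obtain ⟨ξ, hξj, hξ, hq⟩ := ih b hb
    obtain ⟨η, hηj, hη, hηq⟩ := hf.exists_isMaximalVector_succ hc hξj hξ hq s fun t ht => by
      simpa using exists_sub_eq_of_mem_idxSet h ht
    exact ⟨η, hηj, hη, by rw [hηq, qScalar_succ]⟩

end Construction

/-! ### Maximal vectors in submodules of `𝒜 ⊗ V` -/

section Eigenvectors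

open Polynomial

variable {F : Type*} [Field F] {M : Type*} [AddCommGroup M] [Module F M]

/-- If `M` is spanned by eigenvectors of `A` with eigenvalues in `P`, then every vector is
annihilated by a product of factors `A - ν` with `ν ∈ P`. -/
theorem exists_multiset_aeval_eq_zero {A : Module.End F M} {P : F → Prop}
    (h : Submodule.span F {m | ∃ ν, P ν ∧ A m = ν • m} = ⊤) (m : M) :
    ∃ s : Multiset F, (∀ ν ∈ s, P ν) ∧ aeval A (s.map fun ν => X - C ν).prod m = 0 := by
  have hm : m ∈ Submodule.span F {m | ∃ ν, P ν ∧ A m = ν • m} := by rw [h]; trivial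
  induction hm using Submodule.span_induction with
  | mem m hm =>
    obtain ⟨ν, hν, hm⟩ := hm
    exact ⟨{ν}, by simpa using hν, by simp [hm, Module.algebraMap_end_apply]⟩
  | zero => exact ⟨0, by simp, map_zero _⟩
  | add a b _ _ ha hb =>
    obtain ⟨s, hs, ha⟩ := ha
    obtain ⟨t, ht, hb⟩ := hb
    refine ⟨s + t, fun ν hν => (Multiset.mem_add.1 hν).elim (hs ν) (ht ν), ?_⟩
    rw [Multiset.map_add, Multiset.prod_add, map_add]
    nth_rw 1 [mul_comm]
    rw [map_mul, map_mul, Module.End.mul_apply, Module.End.mul_apply, ha, hb, map_zero, map_zero,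
      add_zero]
  | smul c a _ ha =>
    obtain ⟨s, hs, ha⟩ := ha
    exact ⟨s, hs, by rw [map_smul, ha, smul_zero]⟩

/-- A nonzero stable subspace of a space spanned by eigenvectors contains an eigenvector. -/
theorem exists_eigenvector_mem {A : Module.End F M} {P : F → Prop}
    (h : Submodule.span F {m | ∃ ν, P ν ∧ A m = ν • m} = ⊤) {N : Submodule F M}
    (hN : ∀ m ∈ N, A m ∈ N) {m : M} (hm : m ∈ N) (h0 : m ≠ 0) :
    ∃ ν, P ν ∧ ∃ x ∈ N, x ≠ 0 ∧ A x = ν • x := by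
  obtain ⟨s, hs, hsm⟩ := exists_multiset_aeval_eq_zero h m
  induction s using Multiset.induction_on generalizing m with
  | empty => exact absurd (by simpa using hsm) h0
  | cons ν s ih =>
    by_cases hν : A m = ν • m
    · exact ⟨ν, hs ν (Multiset.mem_cons_self ν s), m, hm, h0, hν⟩
    · refine ih (m := A m - ν • m) (sub_mem (hN m hm) (N.smul_mem ν hm)) (sub_ne_zero.2 hν)
        (fun ρ hρ => hs ρ (Multiset.mem_cons_of_mem hρ)) ?_
      rw [Multiset.map_cons, Multiset.prod_cons, mul_comm, map_mul, Module.End.mul_apply] at hsm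
      simpa [Module.algebraMap_end_apply] using hsm

theorem eigenvalue_of_span {A : Module.End F M} {P : F → Prop}
    (h : Submodule.span F {m | ∃ ν, P ν ∧ A m = ν • m} = ⊤) {m : M} (h0 : m ≠ 0) {ν : F}
    (hm : A m = ν • m) : P ν := by
  obtain ⟨ρ, hρ, x, hx, hx0, hxρ⟩ := exists_eigenvector_mem h (N := A.eigenspace ν)
    (fun x hx => by
      rw [Module.End.mem_eigenspace_iff] at hx ⊢
      rw [hx, map_smul, hx]) (Module.End.mem_eigenspace_iff.2 hm) h0
  rw [Module.End.mem_eigenspace_iff, hxρ] at hx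
  rwa [← smul_left_injective F hx0 hx]

end Eigenvectors

section Weights

variable {F : Type*} [Field F] {n : ℕ} {V : Type*} [AddCommGroup V] [Module F V]
  [LieRingModule (Gl F n) V] [LieModule F (Gl F n) V] {μ : Fin n → F}

/-- The identity matrix acts on an irreducible module of highest weight `μ` by `|μ|`. -/
theorem HasHighestWeight.sum_lie_matE_self [LieModule.IsIrreducible F (Gl F n) V]
    (hμ : HasHighestWeight V μ) (v : V) : ∑ i : Fin n, ⁅matE F i i, v⁆ = (∑ k, μ k) • v := by
  obtain ⟨v₀, h0, -, h2⟩ := hμ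
  let Z : Module.End F V := ∑ i : Fin n, LieModule.toEnd F (Gl F n) V (matE F i i)
  have hZ : ∀ v, Z v = ∑ i : Fin n, ⁅matE F i i, v⁆ := fun v => by simp [Z, LinearMap.sum_apply]
  have htop : Z.eigenspace (∑ k, μ k) = ⊤ := by
    refine eq_top_of_matE (F := F) (n := n) (fun i k m hm => ?_) (m := v₀) ?_ h0
    · rw [Module.End.mem_eigenspace_iff] at hm ⊢
      rw [← lie_smul, ← hm, hZ, hZ, lie_sum]
      simp only [lie_lie_matE (F := F) _ _ i k, Finset.sum_add_distrib, Finset.sum_sub_distrib]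
      simp
    · rw [Module.End.mem_eigenspace_iff, hZ]
      simp only [h2, Finset.sum_smul]
  rw [← hZ, ← Module.End.mem_eigenspace_iff, htop]
  trivial

/-- `𝒜 ⊗ V` is spanned by weight vectors whose weights have height at least that of `μ`. -/
theorem HasHighestWeight.span_weight_eq_top [LieModule.IsIrreducible F (Gl F n) V]
    (hμ : HasHighestWeight V μ) :
    Submodule.span F {m : ProjMod F n V | ∃ (w : Fin n → F) (d : ℕ),
      (∀ a, ⁅xd F a a, m⁆ = w a • m) ∧ ht w = ht μ + d} = ⊤ := by
  obtain ⟨v₀, h0, h1, h2⟩ := hμ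
  set N := Submodule.span F {m : ProjMod F n V | ∃ (w : Fin n → F) (d : ℕ),
      (∀ a, ⁅xd F a a, m⁆ = w a • m) ∧ ht w = ht μ + d} with hN
  refine eq_top_of_mulX (fun v => ?_) fun k m hm => ?_
  · let T : V →ₗ[F] ProjMod F n V :=
      { toFun := ten 1, map_add' := ten_add 1, map_smul' := fun c v => ten_smul c 1 v }
    have hle : Submodule.span F {y | IsWord F (fun i k : Fin n => k < i) v₀ y} ≤ N.comap T := by
      refine Submodule.span_le.2 fun y hy => ?_
      obtain ⟨w, d, h3, h4, -⟩ := IsWord.exists_weight h2 hy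
      refine Submodule.subset_span ⟨w, d, fun a => ?_, h4⟩
      change ⁅xd F a a, ten 1 y⁆ = w a • ten 1 y
      rw [lie_xd_ten_one, h3, ten_smul]
    rw [span_isWord_eq_top h0 h1 h2] at hle
    exact hle (x := v) trivial
  · have hle : N ≤ N.comap (mulX k) := by
      refine Submodule.span_le.2 ?_
      rintro m ⟨w, d, h3, h4⟩
      refine Submodule.subset_span ⟨w + Pi.single k 1, d + k, fun a => ?_, ?_⟩
      · rw [lie_xd_mulX, h3, map_smul, Pi.add_apply, add_smul]
        by_cases h : a = k
        · subst h; simp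
        · simp [h]
      · rw [ht_add_single, h4]
        push_cast
        ring
    exact hle hm

/-- A nonzero `gl(n)`-submodule of `𝒜 ⊗ V` contains a maximal vector. -/
theorem HasHighestWeight.exists_isMaximalVector_mem [CharZero F]
    [LieModule.IsIrreducible F (Gl F n) V] (hμ : HasHighestWeight V μ)
    {N : Submodule F (ProjMod F n V)} (hN : ∀ i j : Fin n, ∀ m ∈ N, ⁅xd F i j, m⁆ ∈ N)
    (h0 : N ≠ ⊥) :
    ∃ w, ∃ ξ ∈ N, IsMaximalVector w ξ := by
  let H : Module.End F (ProjMod F n V) :=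
    ∑ i : Fin n, ((i : ℕ) : F) • LieModule.toEnd F (Witt F n) (ProjMod F n V) (xd F i i)
  have hH : ∀ m, H m = ∑ i : Fin n, ((i : ℕ) : F) • ⁅xd F i i, m⁆ := fun m => by
    simp [H, LinearMap.sum_apply]
  have hspan := hμ.span_weight_eq_top
  have hHspan : Submodule.span F {m | ∃ ν : F, (∃ d : ℕ, ν = ht μ + d) ∧ H m = ν • m} = ⊤ := by
    rw [eq_top_iff, ← hspan]
    refine Submodule.span_mono ?_
    rintro m ⟨w, d, h1, h2⟩
    refine ⟨ht w, ⟨d, h2⟩, ?_⟩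
    rw [hH, ht, Finset.sum_smul]
    simp only [h1, smul_smul]
  -- A submodule of vectors of minimal height is killed by the raising operators.
  have hex : ∃ d : ℕ, ∃ m ∈ N, m ≠ 0 ∧ H m = (ht μ + d) • m := by
    obtain ⟨m, hm, hm0⟩ := (Submodule.ne_bot_iff N).1 h0
    obtain ⟨ν, ⟨d, rfl⟩, x, hx, hx0, hxd⟩ := exists_eigenvector_mem hHspan (N := N)
      (fun m hm => by
        rw [hH]
        exact sum_mem fun i _ => N.smul_mem _ (hN i i m hm)) hm hm0
    exact ⟨d, x, hx, hx0, hxd⟩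
  classical
  set d := Nat.find hex with hd
  obtain ⟨m₀, hm₀, hm₀0, hm₀d⟩ := Nat.find_spec hex
  have hHlie : ∀ (i k : Fin n) (m : ProjMod F n V), H ⁅xd F i k, m⁆ =
      ⁅xd F i k, H m⁆ + (((i : ℕ) : F) - ((k : ℕ) : F)) • ⁅xd F i k, m⁆ := by
    intro i k m
    have : ∀ a : Fin n, ((a : ℕ) : F) • ⁅xd F a a, ⁅xd F i k, m⁆⁆ =
        ⁅xd F i k, ((a : ℕ) : F) • ⁅xd F a a, m⁆⁆ +
        ((if a = i then ((a : ℕ) : F) • ⁅xd F a k, m⁆ else 0) -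
          (if k = a then ((a : ℕ) : F) • ⁅xd F i a, m⁆ else 0)) := by
      intro a
      rw [leibniz_lie, lie_xd_xd, sub_lie, smul_add, lie_smul, add_comm, smul_sub]
      split_ifs <;> simp
    rw [hH, hH, lie_sum]
    simp only [this, Finset.sum_add_distrib, Finset.sum_sub_distrib]
    simp [sub_smul]
  have hraise : ∀ m ∈ N, H m = (ht μ + d) • m → ∀ i k : Fin n, i < k → ⁅xd F i k, m⁆ = 0 := by
    intro m hm hmd i k hik
    by_contra hne
    have hev : H ⁅xd F i k, m⁆ = (ht μ + d + (((i : ℕ) : F) - ((k : ℕ) : F))) • ⁅xd F i k, m⁆ := by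
      rw [hHlie, hmd, lie_smul, ← add_smul]
    obtain ⟨e, he⟩ := eigenvalue_of_span hHspan hne hev
    have h1 : d + (i : ℕ) = e + k := by
      have : ((d + (i : ℕ) : ℕ) : F) = ((e + k : ℕ) : F) := by
        push_cast
        linear_combination he
      exact_mod_cast this
    refine Nat.find_min hex (m := e) (by omega) ⟨_, hN i k m hm, hne, ?_⟩
    rw [hev, he]
  have hjoint : ∀ s : Finset (Fin n), ∃ (w : Fin n → F), ∃ m ∈ N, m ≠ 0 ∧
      H m = (ht μ + d) • m ∧ ∀ a ∈ s, ⁅xd F a a, m⁆ = w a • m := by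
    intro s
    induction s using Finset.induction_on with
    | empty => exact ⟨0, m₀, hm₀, hm₀0, hm₀d, by simp⟩
    | insert a s has ih =>
      obtain ⟨w, m, hm, hm0, hmd, hmw⟩ := ih
      let N' : Submodule F (ProjMod F n V) := N ⊓ H.eigenspace (ht μ + d) ⊓
        ⨅ b ∈ s, (LieModule.toEnd F (Witt F n) (ProjMod F n V) (xd F b b)).eigenspace (w b)
      have hN' : ∀ m, m ∈ N' ↔ (m ∈ N ∧ H m = (ht μ + d) • m) ∧
          ∀ b ∈ s, ⁅xd F b b, m⁆ = w b • m := by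
        intro m
        simp [N', Submodule.mem_iInf]
      have haspan : Submodule.span F {m | ∃ ν : F, True ∧
          LieModule.toEnd F (Witt F n) (ProjMod F n V) (xd F a a) m = ν • m} = ⊤ := by
        rw [eq_top_iff, ← hspan]
        refine Submodule.span_mono ?_
        rintro m ⟨w, d, h1, -⟩
        exact ⟨w a, trivial, h1 a⟩
      obtain ⟨ν, -, x, hx, hx0, hxν⟩ := exists_eigenvector_mem haspan (N := N')
        (fun m hm => by
          rw [hN'] at hm ⊢
          obtain ⟨⟨h1, h2⟩, h3⟩ := hm
          simp only [LieModule.toEnd_apply_apply]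
          refine ⟨⟨hN a a m h1, ?_⟩, fun b hb => ?_⟩
          · rw [hHlie, h2, lie_smul, sub_self, zero_smul, add_zero]
          · rw [leibniz_lie, lie_xd_xd, h3 b hb, lie_smul]
            by_cases hab : b = a
            · simp [hab]
            · simp [hab, Ne.symm hab])
        ((hN' m).2 ⟨⟨hm, hmd⟩, hmw⟩) hm0
      obtain ⟨⟨h1, h2⟩, h3⟩ := (hN' x).1 hx
      refine ⟨Function.update w a ν, x, h1, hx0, h2, fun b hb => ?_⟩
      by_cases hab : b = a
      · subst hab
        simpa using hxν
      · rw [Function.update_of_ne hab]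
        exact h3 b (Finset.mem_of_mem_insert_of_ne hb hab)
  obtain ⟨w, m, hm, hm0, hmd, hmw⟩ := hjoint Finset.univ
  exact ⟨w, m, hm, hm0, hraise m hm hmd, fun i => hmw i (Finset.mem_univ i)⟩

/-- `φ` is injective as soon as no `q_c` with `c ∈ I(μ, j)`, `j > 0`, vanishes: its kernel would
contain a maximal vector, and `φ` acts on maximal vectors by the scalars `q_c`. -/
theorem phi_injective_iff [CharZero F] [FiniteDimensional F V]
    [LieModule.IsIrreducible F (Gl F n) V] (hμ : HasHighestWeight V μ) :
    Function.Injective (phi F n V) ↔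
      ∀ j : ℕ, 0 < j → ∀ c ∈ idxSet μ j, qScalar μ c ≠ 0 := by
  obtain ⟨f, hf⟩ : ∃ f : Module.Dual F V, IsLowestDual μ f := by
    obtain ⟨v, h0, h1, h2⟩ := hμ
    exact exists_isLowestDual h0 h1 h2
  have hex := exists_isMaximalVector hμ hf hμ.sum_lie_matE_self
  constructor
  · intro hinj j _ c hc hq
    obtain ⟨ξ, -, hξ, hξq⟩ := hex j c hc
    rw [hq, zero_smul] at hξq
    exact hξ.1 ((injective_iff_map_eq_zero _).1 hinj ξ hξq)
  · intro hq
    rw [← LinearMap.ker_eq_bot]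
    by_contra hne
    obtain ⟨w, ξ, hξ0, hξ⟩ := hμ.exists_isMaximalVector_mem (N := LinearMap.ker (phi F n V))
      (fun i j m hm => by
        rw [LinearMap.mem_ker] at hm ⊢
        rw [phi_lie_xd, hm, lie_zero]) hne
    obtain ⟨c, hc, rfl⟩ := hf.exists_mem_idxSet hξ
    obtain ⟨η, hηj, hη, hηq⟩ := hex _ c hc
    obtain ⟨b, rfl⟩ := hf.exists_smul_eq hη hξ
    rw [LinearMap.mem_ker, map_smul, hηq, smul_comm] at hξ0
    have hq0 : qScalar μ c = 0 := (smul_eq_zero.1 hξ0).resolve_right hξ.1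
    refine hq _ (Nat.pos_of_ne_zero fun hj => ?_) c hc hq0
    have hc0 : c = 0 := funext fun i => (Finset.sum_eq_zero_iff.1 hj) i (Finset.mem_univ i)
    simp [hc0, qScalar] at hq0

end Weights

/-! ### Submodules of `𝒜 ⊗ V` for `L_{n+1}` -/

section Irreducibility

variable {F : Type*} [Field F] {n : ℕ} {V : Type*} [AddCommGroup V] [Module F V]
  [LieRingModule (Gl F n) V] [LieModule F (Gl F n) V]

/-- A subspace stable under the spanning set of `L_{n+1}` is an `L_{n+1}`-submodule. -/
def lieSubmoduleOfProjAlg (N : Submodule F (ProjMod F n V))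
    (h1 : ∀ i j : Fin n, ∀ m ∈ N, ⁅xd F i j, m⁆ ∈ N) (h2 : ∀ i : Fin n, ∀ m ∈ N, ⁅dX F i, m⁆ ∈ N)
    (h3 : ∀ i : Fin n, ∀ m ∈ N, ⁅pT F i, m⁆ ∈ N) :
    LieSubmodule F (projAlg F n) (ProjMod F n V) where
  __ := N
  lie_mem {x m} hm := projSpan_induction F
    (N.comap ((LieModule.toEnd F (Witt F n) (ProjMod F n V)).toLinearMap.flip m))
    (fun i j => h1 i j m hm) (fun i => h2 i m hm) (fun i => h3 i m hm) x.2

/-- The image of `φ` is stable under the partial derivatives, since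
`∂_k p_i = p_i ∂_k + [∂_k, p_i]` with `[∂_k, p_i]` in `gl(n)`. -/
theorem lie_dX_mem_range_phi (k : Fin n) (m : ProjMod F n V) :
    ⁅dX F k, phi F n V m⁆ ∈ LinearMap.range (phi F n V) := by
  have hxd : ∀ i j : Fin n, ∀ m, ⁅xd F i j, phi F n V m⁆ ∈ LinearMap.range (phi F n V) :=
    fun i j m => ⟨⁅xd F i j, m⁆, phi_lie_xd i j m⟩
  have htop : (LinearMap.range (phi F n V)).comap (piOp (dX F k) ∘ₗ phi F n V) = ⊤ := by
    refine eq_top_of_mulX (fun v => ?_) fun i m hm => ?_ <;>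
      simp only [Submodule.mem_comap, LinearMap.comp_apply, ← lie_witt_def] at *
    · rw [phi_ten_one, lie_dX_ten, MvPolynomial.pderiv_one, zero_ten]
      exact zero_mem _
    · rw [phi_mulX, leibniz_lie, lie_dX_pT, add_lie]
      refine add_mem (add_mem (hxd _ _ _) ?_) ?_
      · split_ifs
        · rw [sum_lie]
          exact sum_mem fun a _ => hxd _ _ _
        · rw [zero_lie]
          exact zero_mem _
      · obtain ⟨y, hy⟩ := hm
        exact ⟨mulX i y, by rw [phi_mulX, hy]⟩
  have hm : m ∈ (LinearMap.range (phi F n V)).comap (piOp (dX F k) ∘ₗ phi F n V) := by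
    rw [htop]; trivial
  exact hm

theorem range_phi_eq_top_of_isIrreducible
    [LieModule.IsIrreducible F (projAlg F n) (ProjMod F n V)] {v : V} (hv : v ≠ 0) :
    LinearMap.range (phi F n V) = ⊤ := by
  let N := lieSubmoduleOfProjAlg (LinearMap.range (phi F n V))
    (by rintro i j _ ⟨m, rfl⟩; exact ⟨⁅xd F i j, m⁆, phi_lie_xd i j m⟩)
    (by rintro i _ ⟨m, rfl⟩; exact lie_dX_mem_range_phi i m)
    (by rintro i _ ⟨m, rfl⟩; exact ⟨mulX i m, phi_mulX i m⟩)
  have hmem : ∀ m, m ∈ N ↔ m ∈ LinearMap.range (phi F n V) := fun _ => Iff.rfl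
  have hN : N ≠ ⊥ := by
    intro h
    have : ten 1 v ∈ N := (hmem _).2 ⟨ten 1 v, phi_ten_one v⟩
    rw [h, LieSubmodule.mem_bot] at this
    exact ten_one_ne_zero hv this
  have htop := (IsSimpleOrder.eq_bot_or_eq_top N).resolve_left hN
  refine eq_top_iff.2 fun m _ => (hmem m).1 ?_
  rw [htop]
  trivial

/-- In characteristic zero the vectors killed by all partial derivatives are those of `1 ⊗ V`. -/
theorem exists_eq_ten_one [CharZero F] [FiniteDimensional F V] {m : ProjMod F n V}
    (h : ∀ k : Fin n, ⁅dX F k, m⁆ = 0) : ∃ v : V, m = ten 1 v := by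
  have hconst : ∀ g : V →ₗ[F] F,
      contr g m = MvPolynomial.coeff 0 (contr g m) • (1 : Poly F n) := by
    intro g
    ext c
    rw [MvPolynomial.coeff_smul, MvPolynomial.coeff_one]
    split_ifs with hc
    · rw [hc, smul_eq_mul, mul_one]
    · obtain ⟨k, hk⟩ : ∃ k, c k ≠ 0 := by
        by_contra! h0
        exact hc (Finsupp.ext fun k => (h0 k).symm)
      have h1 := contr_lie_dX g k m
      rw [h k, map_zero] at h1
      have h2 := congrArg (MvPolynomial.coeff (c - Finsupp.single k 1)) h1.symm
      rw [MvPolynomial.coeff_pderiv, MvPolynomial.coeff_zero, tsub_add_cancel_of_le] at h2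
      · rw [smul_zero]
        exact (mul_eq_zero.1 h2).resolve_right (Nat.cast_add_one_ne_zero _)
      · rw [Finsupp.single_le_iff]
        omega
  let b := Module.finBasis F V
  refine ⟨∑ i, MvPolynomial.coeff 0 (contr (b.coord i) m) • b i, ?_⟩
  conv_lhs => rw [← sum_ten_contr b m]
  rw [ten_sum]
  refine Finset.sum_congr rfl fun i _ => ?_
  conv_lhs => rw [hconst]
  rw [smul_ten, ten_smul]

theorem lie_dX_degProj_zero (k : Fin n) (m : ProjMod F n V) : ⁅dX F k, degProj 0 m⁆ = 0 := by
  have htop : LinearMap.ker (piOp (dX F k) ∘ₗ degProj 0 : Module.End F (ProjMod F n V)) = ⊤ := by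
    refine eq_top_of_mulX (fun v => ?_) fun i m hm => ?_ <;>
      simp only [LinearMap.mem_ker, LinearMap.comp_apply, ← lie_witt_def] at *
    · rw [degProj_ten_one, if_pos rfl, lie_dX_ten, MvPolynomial.pderiv_one, zero_ten]
    · rw [degProj_zero_mulX, lie_zero]
  have hm : m ∈ LinearMap.ker (piOp (dX F k) ∘ₗ degProj 0 : Module.End F (ProjMod F n V)) := by
    rw [htop]; trivial
  exact hm

theorem degProj_lie_dX (j : ℕ) (k : Fin n) (m : ProjMod F n V) :
    degProj j ⁅dX F k, m⁆ = ⁅dX F k, degProj (j + 1) m⁆ := by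
  have htop : ⨅ j, LinearMap.eqLocus (degProj j ∘ₗ piOp (dX F k))
      (piOp (dX F k) ∘ₗ degProj (j + 1) : Module.End F (ProjMod F n V)) = ⊤ := by
    refine eq_top_of_mulX (fun v => ?_) fun i m hm => ?_ <;>
      simp only [Submodule.mem_iInf, LinearMap.mem_eqLocus, LinearMap.comp_apply,
        ← lie_witt_def] at *
    · intro j
      rw [lie_dX_ten, MvPolynomial.pderiv_one, zero_ten, map_zero, degProj_ten_one,
        if_neg (Nat.succ_ne_zero j), lie_zero]
    · rintro (_ | j)
      · rw [degProj_succ_mulX, lie_dX_mulX, lie_dX_mulX, map_add, degProj_zero_mulX,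
          lie_dX_degProj_zero, map_zero]
        split_ifs
        · rfl
        · rw [map_zero]
      · rw [degProj_succ_mulX, lie_dX_mulX, map_add, degProj_succ_mulX, hm, lie_dX_mulX]
        split_ifs
        · rfl
        · rw [map_zero]
  have hm : m ∈ ⨅ j, LinearMap.eqLocus (degProj j ∘ₗ piOp (dX F k))
      (piOp (dX F k) ∘ₗ degProj (j + 1) : Module.End F (ProjMod F n V)) := by
    rw [htop]; trivial
  exact (Submodule.mem_iInf _).1 hm j

/-- A nonzero subspace stable under the partial derivatives meets `1 ⊗ V`. -/
theorem exists_ten_one_mem [CharZero F] [FiniteDimensional F V] {N : Submodule F (ProjMod F n V)}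
    (hN : ∀ i : Fin n, ∀ m ∈ N, ⁅dX F i, m⁆ ∈ N) (h0 : N ≠ ⊥) :
    ∃ v : V, v ≠ 0 ∧ ten 1 v ∈ N := by
  have key : ∀ d : ℕ, ∀ m ∈ N, m ≠ 0 → (∀ j ≥ d, degProj j m = 0) →
      ∃ v : V, v ≠ 0 ∧ ten 1 v ∈ N := by
    intro d
    induction d with
    | zero => exact fun m _ h1 h2 => absurd (eq_zero_of_degProj fun j => h2 j (Nat.zero_le j)) h1
    | succ d ih =>
      intro m hm h1 h2
      by_cases h3 : ∀ k : Fin n, ⁅dX F k, m⁆ = 0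
      · obtain ⟨v, rfl⟩ := exists_eq_ten_one h3
        exact ⟨v, fun hv => h1 (by rw [hv, ten_zero]), hm⟩
      · obtain ⟨k, hk⟩ := not_forall.1 h3
        refine ih _ (hN k m hm) hk fun j hj => ?_
        rw [degProj_lie_dX, h2 (j + 1) (by omega), lie_zero]
  obtain ⟨m, hm, hm0⟩ := (Submodule.ne_bot_iff N).1 h0
  obtain ⟨d, hd⟩ := exists_sum_degProj m
  refine key d m hm hm0 fun j hj => ?_
  have := hd (j + 1) (by omega)
  rw [Finset.sum_range_succ, hd j hj] at this
  simpa using this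

theorem isIrreducible_of_range_phi_eq_top [CharZero F] [FiniteDimensional F V]
    [LieModule.IsIrreducible F (Gl F n) V] {v : V} (hv : v ≠ 0)
    (h : LinearMap.range (phi F n V) = ⊤) :
    LieModule.IsIrreducible F (projAlg F n) (ProjMod F n V) := by
  have : Nontrivial (ProjMod F n V) := ⟨⟨_, 0, ten_one_ne_zero hv⟩⟩
  refine LieModule.IsIrreducible.mk fun N hN => ?_
  have h1 : ∀ i j : Fin n, ∀ m ∈ N, ⁅xd F i j, m⁆ ∈ N := fun i j m hm =>
    N.lie_mem (x := ⟨xd F i j, xd_mem F i j⟩) hm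
  have h2 : ∀ i : Fin n, ∀ m ∈ N, ⁅dX F i, m⁆ ∈ N := fun i m hm =>
    N.lie_mem (x := ⟨dX F i, dX_mem F i⟩) hm
  have h3 : ∀ i : Fin n, ∀ m ∈ N, ⁅pT F i, m⁆ ∈ N := fun i m hm =>
    N.lie_mem (x := ⟨pT F i, pT_mem F i⟩) hm
  obtain ⟨u, hu0, hu⟩ := exists_ten_one_mem (N := N.toSubmodule) h2
    (by simpa using hN)
  let T : V →ₗ[F] ProjMod F n V :=
    { toFun := ten 1, map_add' := ten_add 1, map_smul' := fun c v => ten_smul c 1 v }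
  have hV : N.toSubmodule.comap T = ⊤ := eq_top_of_matE (F := F) (n := n)
    (fun i k m hm => by
      change ten 1 ⁅matE F i k, m⁆ ∈ N
      rw [← lie_xd_ten_one]
      exact h1 i k _ hm) (m := u) hu hu0
  have hφ : N.toSubmodule.comap (phi F n V) = ⊤ := by
    refine eq_top_of_mulX (fun w => ?_) fun k m hm => ?_
    · rw [Submodule.mem_comap, phi_ten_one]
      have : w ∈ N.toSubmodule.comap T := by rw [hV]; trivial
      exact this
    · rw [Submodule.mem_comap, phi_mulX]
      exact h3 k _ hm
  refine eq_top_iff.2 fun m _ => ?_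
  obtain ⟨y, rfl⟩ : m ∈ LinearMap.range (phi F n V) := by rw [h]; trivial
  have : y ∈ N.toSubmodule.comap (phi F n V) := by rw [hφ]; trivial
  exact this

end Irreducibility

section PseudoGen

variable {F : Type*} [Field F] {n : ℕ} {V : Type*} [AddCommGroup V] [Module F V]
  [LieRingModule (Gl F n) V] [LieModule F (Gl F n) V]

/-- If a representation of a Lie algebra preserves a subspace, so does the representation of its
universal enveloping algebra. -/
theorem lift_toEnd_mem {L M : Type*} [LieRing L] [LieAlgebra F L] [AddCommGroup M] [Module F M]
    [LieRingModule L M] [LieModule F L M] {N : Submodule F M} (hN : ∀ x : L, ∀ m ∈ N, ⁅x, m⁆ ∈ N)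
    (u : UniversalEnvelopingAlgebra F L) {m : M} (hm : m ∈ N) :
    UniversalEnvelopingAlgebra.lift F (LieModule.toEnd F L M) u m ∈ N := by
  let S : Subalgebra F (Module.End F M) :=
    { carrier := {T | ∀ m ∈ N, T m ∈ N}
      mul_mem' := fun hS hT m hm => hS _ (hT m hm)
      add_mem' := fun hS hT m hm => N.add_mem (hS m hm) (hT m hm)
      algebraMap_mem' := fun c m hm => N.smul_mem c hm }
  let g : L →ₗ⁅F⁆ S :=
    { toFun := fun x => ⟨LieModule.toEnd F L M x, hN x⟩
      map_add' := fun x y => Subtype.ext (map_add _ x y)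
      map_smul' := fun c x => Subtype.ext (map_smul _ c x)
      map_lie' := fun {x y} => Subtype.ext (LieHom.map_lie _ x y) }
  have h : S.val.comp (UniversalEnvelopingAlgebra.lift F g) =
      UniversalEnvelopingAlgebra.lift F (LieModule.toEnd F L M) := by
    refine UniversalEnvelopingAlgebra.hom_ext F (LieHom.ext fun x => ?_)
    simp [g]
  rw [← h]
  exact (UniversalEnvelopingAlgebra.lift F g u).2 m hm

/-- `U(P)(1 ⊗ V)` is the image of `φ`. -/
theorem pseudoGen_eq_range_phi : pseudoGen F n V = LinearMap.range (phi F n V) := by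
  apply le_antisymm
  · refine Submodule.span_le.2 ?_
    rintro _ ⟨u, v, rfl⟩
    refine lift_toEnd_mem (fun x m hm => ?_) u ⟨ten 1 v, phi_ten_one v⟩
    obtain ⟨m, rfl⟩ := hm
    obtain ⟨D, hD⟩ := x
    change ⁅D, phi F n V m⁆ ∈ _
    have hle : Submodule.span F (Set.range (pT F)) ≤ (LinearMap.range (phi F n V)).comap
        ((LieModule.toEnd F (Witt F n) (ProjMod F n V)).toLinearMap.flip (phi F n V m)) := by
      refine Submodule.span_le.2 ?_
      rintro _ ⟨i, rfl⟩
      exact ⟨mulX i m, phi_mulX i m⟩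
    exact hle hD
  · have hp : ∀ k : Fin n, ∀ m ∈ pseudoGen F n V, ⁅pT F k, m⁆ ∈ pseudoGen F n V := by
      intro k m hm
      let p : pseudoTrans F n := ⟨pT F k, Submodule.subset_span ⟨k, rfl⟩⟩
      have hle : pseudoGen F n V ≤ (pseudoGen F n V).comap (piOp (pT F k)) := by
        refine Submodule.span_le.2 ?_
        rintro _ ⟨u, v, rfl⟩
        refine Submodule.subset_span ⟨UniversalEnvelopingAlgebra.ι F p * u, v, ?_⟩
        rw [map_mul, UniversalEnvelopingAlgebra.lift_ι_apply]
        rfl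
      exact hle hm
    have htop : (pseudoGen F n V).comap (phi F n V) = ⊤ := by
      refine eq_top_of_mulX (fun v => ?_) fun k m hm => ?_
      · rw [Submodule.mem_comap, phi_ten_one]
        exact Submodule.subset_span ⟨1, v, by simp⟩
      · rw [Submodule.mem_comap, phi_mulX]
        exact hp k _ hm
    rintro _ ⟨m, rfl⟩
    have : m ∈ (pseudoGen F n V).comap (phi F n V) := by rw [htop]; trivial
    exact this

end PseudoGen

end

end GenProj

theorem proposition3p2p4 {F : Type*} [Field F] [CharZero F] (n : ℕ)
    (V : Type*) [AddCommGroup V] [Module F V] [FiniteDimensional F V]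
    [LieRingModule (GenProj.Gl F n) V] [LieModule F (GenProj.Gl F n) V]
    [LieModule.IsIrreducible F (GenProj.Gl F n) V]
    (μ : Fin n → F) (hμ : GenProj.HasHighestWeight V μ) :
    -- `q_c` is the scalar by which `φ_j` acts on the maximal vectors of weight `μ + c`
    (∀ j : ℕ, ∀ c ∈ GenProj.idxSet μ j,
      (∃ ξ ∈ GenProj.degPart F n V j, GenProj.IsMaximalVector (fun i => μ i + (c i : F)) ξ) ∧
      ∀ ξ ∈ GenProj.degPart F n V j, GenProj.IsMaximalVector (fun i => μ i + (c i : F)) ξ →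
        GenProj.phi F n V ξ = GenProj.qScalar μ c • ξ) ∧
    (LieModule.IsIrreducible F (GenProj.projAlg F n) (GenProj.ProjMod F n V) ↔
      ∀ j : ℕ, 0 < j → ∀ c ∈ GenProj.idxSet μ j, GenProj.qScalar μ c ≠ 0) ∧
    (LieModule.IsIrreducible F (GenProj.projAlg F n) (GenProj.ProjMod F n V) ↔
      GenProj.pseudoGen F n V = ⊤) := by
  obtain ⟨v, hv, hv1, hv2⟩ := id hμ
  obtain ⟨f, hf⟩ := GenProj.exists_isLowestDual hv hv1 hv2
  have htrace := hμ.sum_lie_matE_self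
  have hirr : LieModule.IsIrreducible F (GenProj.projAlg F n) (GenProj.ProjMod F n V) ↔
      LinearMap.range (GenProj.phi F n V) = ⊤ :=
    ⟨fun _ => GenProj.range_phi_eq_top_of_isIrreducible hv,
      GenProj.isIrreducible_of_range_phi_eq_top hv⟩
  refine ⟨fun j c hc => ?_, ?_, ?_⟩
  · obtain ⟨η, hηj, hη, hηq⟩ := GenProj.exists_isMaximalVector hμ hf htrace j c hc
    refine ⟨⟨η, hηj, hη⟩, fun ξ _ hξ => ?_⟩
    obtain ⟨b, rfl⟩ := hf.exists_smul_eq hη hξ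
    rw [map_smul, hηq, smul_comm]
  · rw [hirr, LinearMap.range_eq_top, ← GenProj.phi_injective_iff_surjective htrace,
      GenProj.phi_injective_iff hμ]
  · rw [hirr, GenProj.pseudoGen_eq_range_phi]
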